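/- For $0<q<1$ and real $x$ put $(x;q)_0=1$, $(x;q)_n=\prod_{k=0}^{n-1}(1-xq^k)$, and let $$\Phi[a,b;c;q,z]=\sum_{n=0}^\infty\frac{(a;q)_n(b;q)_n}{(c;q)_n(q;q)_n}z^n\qquad(|z|<1)$$ be Heine's basic hypergeometric function. A domain $D\subset\mathbb C$ is called convex in the direction of the imaginary axis if its intersection with every line parallel to the imaginary axis is empty or a (possibly unbounded) line segment. Let $q\in(0,1)$ and let $a,b,c$ be non-negative real numbers with $0\le q(b-c)\le 1-cq$ and $0<a-c\le 1-c$. Then there is a non-decreasing function $\mu:[0,1]\to[0,1]$ with $\mu(1)-\mu(0)=1$ such that, for all $z$ with $|z|<1$ and $z\notin[q,\infty)$, $\Phi[a,b;c;q,z]\neq0$ and $$\frac{z\,\Phi[a,bq;cq;q,z]}{\Phi[a,b;c;q,z]}=\int_0^1\frac{qz}{q-tz}\,d\mu(t).$$ The function $z\mapsto\int_0^1\frac{qz}{q-tz}\,d\mu(t)$ is analytic in the cut plane $\mathbb C\setminus[q,\infty)$, and it maps both the disk $\{|z|<q\}$ and the half-plane $\{\operatorname{Re}z<q\}$ univalently onto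 domains convex in the direction of the imaginary axis. If moreover $\Phi[a,b;c;q,\cdot]$ has no zero in the unit disk $\{|z|<1\}$, then $z\mapsto z\,\Phi[a,bq;cq;q,z]/\Phi[a,b;c;q,z]$ also maps the unit disk univalently onto a domain convex in the direction of the imaginary axis. -/

import Mathlib

open MeasureTheory

/-- Watson's symbol (the `q`-shifted factorial)
`(a;q)_n = (1 - a) (1 - a q) ⋯ (1 - a q ^ (n - 1))`, with `(a;q)_0 = 1`. -/
noncomputable def watsonSymbol (a q : ℂ) (n : ℕ) : ℂ :=
  ∏ k ∈ Finset.range n, (1 - a * q ^ k)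

/-- Heine's basic hypergeometric function
`Φ[a, b; c; q, z] = ∑ (a;q)_n (b;q)_n / ((c;q)_n (q;q)_n) z ^ n`.
The series converges absolutely for `|q| < 1`, `|z| < 1` when no `(c;q)_n` vanishes, and the
function is only used for such arguments. -/
noncomputable def heinePhi (a b c q z : ℂ) : ℂ :=
  ∑' n : ℕ, watsonSymbol a q n * watsonSymbol b q n /
    (watsonSymbol c q n * watsonSymbol q q n) * z ^ n

/-- The cut plane `ℂ ∖ [q, ∞)`. -/
def cutPlane (q : ℝ) : Set ℂ := {z | ¬ ∃ x : ℝ, q ≤ x ∧ z = (x : ℂ)}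

/-- The Lebesgue–Stieltjes measure `dμ` of a non-decreasing `μ : [0,1] → [0,1]`.
The function is extended to `ℝ` by the constants `μ 0` on the left and `μ 1` on the right, so that
a jump at an end point of `[0,1]` contributes an atom there (of mass `μ(0+) - μ(0)` at `0` and
`μ(1) - μ(1-)` at `1`), exactly as in the Riemann–Stieltjes integral over `[0,1]`. -/
noncomputable def stieltjesMeasure (μ : Set.Icc (0 : ℝ) 1 →o Set.Icc (0 : ℝ) 1) : Measure ℝ :=
  (Monotone.stieltjesFunction
    (f := Set.IccExtend (zero_le_one' ℝ) (fun t => (μ t : ℝ)))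
    (Monotone.IccExtend (zero_le_one' ℝ) (fun _ _ h => μ.monotone h))).measure

/-- The function `z ↦ ∫₀¹ q z / (q - t z) dμ(t)`. -/
noncomputable def stieltjesTransform (q : ℝ) (μ : Set.Icc (0 : ℝ) 1 →o Set.Icc (0 : ℝ) 1)
    (z : ℂ) : ℂ :=
  ∫ t in Set.Icc (0 : ℝ) 1, ((q : ℂ) * z) / ((q : ℂ) - (t : ℂ) * z) ∂(stieltjesMeasure μ)

/-- A domain (non-empty, open, connected set) which meets every line parallel to the imaginary
axis in a convex set, i.e. in the empty set or a (possibly unbounded) line segment. -/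
def IsDomainConvexInImagDirection (D : Set ℂ) : Prop :=
  IsOpen D ∧ IsConnected D ∧ ∀ x : ℝ, Convex ℝ (D ∩ {w : ℂ | w.re = x})

/-- `f` is analytic and one-to-one on `U`, and maps `U` onto a domain which is convex in the
direction of the imaginary axis. -/
def MapsUnivalentlyOntoConvexInImagDirection (f : ℂ → ℂ) (U : Set ℂ) : Prop :=
  AnalyticOnNhd ℂ f U ∧ Set.InjOn f U ∧ IsDomainConvexInImagDirection (f '' U)

/-! Write F_n for Heine's function at the n-th iterate of the shift (a, b, c) ↦ (bq, a, cq). By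
symmetry in the numerator parameters, z F_1/F_0 is the quotient in question. Heine's contiguous
relation F_{n+1} = F_n + d_n z F_{n+2} expands F_1/F_0 into a continued fraction, and q d_n = (1 -
g_n) g_{n+1} with g_n = (a_n - c_n)/(1 - c_n) in [0, 1]. Because of this chain-sequence form, the
Jacobi matrix J with zero diagonal and off-diagonal entries √(q d_n) is a self-adjoint contraction
of ℓ². Suitably scaled, the F_n form an ℓ² solution of (1 - sJ)U = F_0 e_0 with s² = z/q. The
spectral measure ν of J² at e_0 then gives F_1 = F_0 ∫ dν(t)/(1 - tz/q) off the cut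
(`HeineAdmissible.exists_measure`).

This identity involves no division, so a zero of F_0 at z forces F_n(z) = 0 for all n. But F_n tends
to Φ[0,0;0;q,·], which has no zero in the unit disk (`HeineAdmissible.heineAt_ne_zero`).

The mapping properties hold for every transform f(z) = ∫ z/(1 - tz) dν(t) with ν a probability
measure on [0, R], on Re z < 1/R. Im f has the sign of Im z, and the divided difference of f does
not vanish for two points of one closed half-plane, so f is injective. On a circle centred on the
real axis Re f increases strictly with Re z, so a vertical line meets the image of the circle at
most twice and the image of the disk in an interval (`convex_slice_cauchyTransform_ball`).

If Φ has no zero in the unit disk, the Taylor coefficients of the quotient, which are moments of ν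
divided by q^n, decay fast enough to confine ν to [0, q] (`ae_le_of_analytic_continuation`). After
rescaling, the same mapping result applies with R = 1. -/

/-! ### Spectral measure of the square of a self-adjoint contraction. -/

open scoped InnerProductSpace CompactlySupported in
/-- The spectral measure of the square of a self-adjoint contraction at a unit vector. -/
theorem exists_spectralMeasure_sq {H : Type*} [NormedAddCommGroup H] [InnerProductSpace ℂ H]
    [CompleteSpace H] (T : H →L[ℂ] H) (hT : IsSelfAdjoint T) (hn : ‖T‖ ≤ 1) (e : H)
    (he : ‖e‖ = 1) :
    ∃ ν : Measure ℝ, IsProbabilityMeasure ν ∧ (∀ᵐ t ∂ν, t ∈ Set.Icc (0 : ℝ) 1) ∧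
      ∀ w : ℂ, (∀ t ∈ Set.Icc (0 : ℝ) 1, 1 - (t : ℂ) * w ≠ 0) → ∀ (V : H) (φ : ℂ),
        V - w • T (T V) = φ • e → ⟪e, V⟫_ℂ = φ * ∫ t : ℝ, 1 / (1 - (t : ℂ) * w) ∂ν := by
  set A : H →L[ℂ] H := T * T with hA
  have hAsa : IsSelfAdjoint A := by
    rw [hA, IsSelfAdjoint, star_mul, hT.star_eq]
  have : Nontrivial H := ⟨e, 0, by rintro rfl; simp at he⟩
  have hspec : ∀ t ∈ spectrum ℝ A, t ∈ Set.Icc (0 : ℝ) 1 := by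
    intro t ht
    have h0 : 0 ≤ A := by
      have := star_mul_self_nonneg T
      rwa [hT.star_eq] at this
    refine ⟨spectrum_nonneg_of_nonneg h0 ht, ?_⟩
    have h1 : ‖t‖ ≤ ‖A‖ := spectrum.norm_le_norm_of_mem ht
    have h2 : ‖A‖ ≤ 1 := (norm_mul_le _ _).trans (by nlinarith [norm_nonneg T])
    exact (le_abs_self t).trans (h1.trans h2)
  -- Riesz–Markov is applied to the positive functional f ↦ ⟨e, f(A)e⟩ on the compact spectrum of A
  -- = T².
  let Ψ : C(spectrum ℝ A, ℝ) →⋆ₐ[ℝ] (H →L[ℂ] H) := cfcHom hAsa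
  let Λ₀ : C_c(spectrum ℝ A, ℝ) →ₗ[ℝ] ℝ :=
    { toFun := fun f => (⟪e, Ψ f.toContinuousMap e⟫_ℂ).re
      map_add' := by
        intro f g
        have : (f + g).toContinuousMap = f.toContinuousMap + g.toContinuousMap := rfl
        simp [this]
      map_smul' := by
        intro r f
        have : (r • f).toContinuousMap = r • f.toContinuousMap := rfl
        simp only [this, map_smul]
        rw [show (r • Ψ f.toContinuousMap) e = (r : ℂ) • Ψ f.toContinuousMap e by simp,
          inner_smul_right]
        simp }
  have hΛ₀ : ∀ f, 0 ≤ f → 0 ≤ Λ₀ f := by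
    intro f hf
    have h1 : 0 ≤ Ψ f.toContinuousMap := by
      apply (cfcHom_nonneg_iff hAsa).2
      exact fun x => hf x
    have h2 := ((ContinuousLinearMap.nonneg_iff_isPositive _).1 h1).inner_nonneg_right e
    exact (Complex.nonneg_iff.1 h2).1
  let Λ : C_c(spectrum ℝ A, ℝ) →ₚ[ℝ] ℝ := PositiveLinearMap.mk₀ Λ₀ hΛ₀
  let μ := RealRMK.rieszMeasure Λ
  have hint : ∀ f : C(spectrum ℝ A, ℝ), ∫ x, f x ∂μ = (⟪e, Ψ f e⟫_ℂ).re := by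
    intro f
    exact RealRMK.integral_rieszMeasure Λ ⟨f, HasCompactSupport.of_compactSpace _⟩
  have him : ∀ f : C(spectrum ℝ A, ℝ), (⟪e, Ψ f e⟫_ℂ).im = 0 := by
    intro f
    have h1 : IsSelfAdjoint (Ψ f) := by
      rw [IsSelfAdjoint, ← map_star]; congr 1
    have h2 := h1.isSymmetric.im_inner_self_apply e
    rw [← inner_conj_symm]
    simpa using h2
  have : IsProbabilityMeasure μ := by
    have h1 := hint 1
    simp [he] at h1
    constructor
    rwa [Measure.real, ENNReal.toReal_eq_one_iff] at h1
  refine ⟨μ.map Subtype.val, Measure.isProbabilityMeasure_map (by fun_prop), ?_, ?_⟩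
  · refine (ae_map_iff (p := fun t : ℝ => t ∈ Set.Icc (0 : ℝ) 1)
      measurable_subtype_coe.aemeasurable measurableSet_Icc).2 ?_
    exact Filter.Eventually.of_forall fun x => hspec x x.2
  intro w hw V φ hV
  have hcont : Continuous fun x : spectrum ℝ A => 1 / (1 - ((x : ℝ) : ℂ) * w) := by
    refine Continuous.div continuous_const (by fun_prop) fun x => hw x (hspec x x.2)
  -- The functional calculus is over ℝ, so the resolvent kernel 1/(1 - tw) is split into real and
  -- imaginary parts f and g.
  let f : C(spectrum ℝ A, ℝ) := ⟨_, Complex.continuous_re.comp hcont⟩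
  let g : C(spectrum ℝ A, ℝ) := ⟨_, Complex.continuous_im.comp hcont⟩
  let ι : C(spectrum ℝ A, ℝ) := ⟨_, continuous_subtype_val⟩
  have hι : Ψ ι = A := cfcHom_id hAsa
  have key : ∀ x : spectrum ℝ A,
      ((f x : ℂ) + g x * Complex.I) * (1 - ((x : ℝ) : ℂ) * w) = 1 := by
    intro x
    have : ((f x : ℂ) + g x * Complex.I) = 1 / (1 - ((x : ℝ) : ℂ) * w) := Complex.re_add_im _
    rw [this, one_div, inv_mul_cancel₀ (hw x (hspec x x.2))]
  have e1 : f * (1 - w.re • ι) + w.im • (g * ι) = 1 := by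
    ext x
    have := congrArg Complex.re (key x)
    simp at this
    simp [ι]
    linarith
  have e2 : g * (1 - w.re • ι) - w.im • (f * ι) = 0 := by
    ext x
    have := congrArg Complex.im (key x)
    simp at this
    simp [ι]
    linarith
  have E1 := congrArg Ψ e1
  have E2 := congrArg Ψ e2
  simp only [map_add, map_sub, map_mul, map_smul, map_one, hι, map_zero] at E1 E2
  -- f(A) + i g(A) is a left inverse of 1 - wA, which is all that is needed to recover V from φ e.
  have hR : ∀ x : H, Ψ f (x - w • A x) + Complex.I • Ψ g (x - w • A x) = x := by
    intro x
    have h1 := congrArg (fun B : H →L[ℂ] H => B x) E1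
    have h2 := congrArg (fun B : H →L[ℂ] H => B x) E2
    simp at h1 h2
    have hr : ∀ (r : ℝ) (y : H), r • y = (r : ℂ) • y := fun r y => by simp
    simp only [hr] at h1 h2
    have hw' : w = (w.re : ℂ) + w.im * Complex.I := (Complex.re_add_im w).symm
    simp only [map_sub, map_smul]
    have aux : ∀ (p q r s : H) (u v : ℂ),
        (p - (u + v * Complex.I) • q) + Complex.I • (r - (u + v * Complex.I) • s) =
          (p - u • q + v • s) + Complex.I • (r - u • s - v • q) := by
      intro p q r s u v
      have : Complex.I * (v * Complex.I) = - v := by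
        rw [mul_left_comm, Complex.I_mul_I]; simp
      simp only [smul_sub, add_smul, smul_add, smul_smul, this]
      module
    have h3 := aux (Ψ f x) (Ψ f (A x)) (Ψ g x) (Ψ g (A x)) w.re w.im
    rwa [h1, h2, smul_zero, add_zero, ← hw'] at h3
  have hV' := hR V
  rw [show V - w • A V = φ • e from hV] at hV'
  have hval : ⟪e, V⟫_ℂ = φ * (⟪e, Ψ f e⟫_ℂ + Complex.I * ⟪e, Ψ g e⟫_ℂ) := by
    rw [← hV']
    simp only [map_smul, inner_add_right, inner_smul_right]
    ring
  rw [hval, integral_map (by fun_prop) (by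
    exact (Measurable.aestronglyMeasurable (by fun_prop)))]
  congr 1
  have hi : Integrable (fun x : spectrum ℝ A => 1 / (1 - ((x : ℝ) : ℂ) * w)) μ :=
    hcont.integrable_of_hasCompactSupport (HasCompactSupport.of_compactSpace _)
  have hfe : ⟪e, Ψ f e⟫_ℂ = ((∫ x, f x ∂μ : ℝ) : ℂ) := by
    rw [hint]; apply Complex.ext <;> simp [him]
  have hge : ⟪e, Ψ g e⟫_ℂ = ((∫ x, g x ∂μ : ℝ) : ℂ) := by
    rw [hint]; apply Complex.ext <;> simp [him]
  rw [hfe, hge, ← integral_re_add_im hi]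
  simp only [RCLike.I_to_complex]
  rw [mul_comm Complex.I]
  rfl

/-! ### Jacobi operators of chain sequences. -/

/-- The coordinates of the Jacobi operator with zero diagonal and off-diagonal entries `β`. -/
def jacobiFun (β : ℕ → ℝ) (x : ℕ → ℂ) : ℕ → ℂ
  | 0 => β 1 * x 1
  | n + 1 => β (n + 1) * x n + β (n + 2) * x (n + 2)

/-- Cauchy–Schwarz with the weights p and 1 - p. -/
theorem norm_sq_add_le {p r : ℝ} (hp : 0 ≤ p) (hr : 0 ≤ r) (hp1 : p ≤ 1) (s : ℝ) (hs : 0 ≤ s)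
    (x y : ℂ) :
    ‖(√(r * p) : ℝ) * x + (√((1 - p) * s) : ℝ) * y‖ ^ 2 ≤ r * ‖x‖ ^ 2 + s * ‖y‖ ^ 2 := by
  have h1 : ‖(√(r * p) : ℝ) * x + (√((1 - p) * s) : ℝ) * y‖ ≤
      √p * (√r * ‖x‖) + √(1 - p) * (√s * ‖y‖) := by
    refine (norm_add_le _ _).trans (le_of_eq ?_)
    rw [norm_mul, norm_mul, Complex.norm_real, Complex.norm_real, Real.norm_of_nonneg (by positivity),
      Real.norm_of_nonneg (by positivity), Real.sqrt_mul hr, Real.sqrt_mul (by linarith)]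
    ring
  refine (pow_le_pow_left₀ (norm_nonneg _) h1 2).trans ?_
  have e1 := Real.sq_sqrt hp
  have e2 := Real.sq_sqrt hr
  have e3 := Real.sq_sqrt hs
  have e4 := Real.sq_sqrt (sub_nonneg.2 hp1)
  have : r * ‖x‖ ^ 2 + s * ‖y‖ ^ 2 = (√p ^ 2 + √(1 - p) ^ 2) * ((√r * ‖x‖) ^ 2 + (√s * ‖y‖) ^ 2) := by
    rw [e1, e4, mul_pow, mul_pow, e2, e3]; ring
  rw [this]
  nlinarith [sq_nonneg (√p * (√s * ‖y‖) - √(1 - p) * (√r * ‖x‖))]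

/-- The off-diagonal entries attached to a parameter sequence `g`. -/
noncomputable def chainCoeff (g : ℕ → ℝ) (n : ℕ) : ℝ := √((1 - g (n - 1)) * g n)

theorem norm_sq_jacobiFun_le {g : ℕ → ℝ} (hg : ∀ n, g n ∈ Set.Icc (0 : ℝ) 1) (x : ℕ → ℂ) (n : ℕ) :
    ‖jacobiFun (chainCoeff g) x (n + 1)‖ ^ 2 ≤
      (1 - g n) * ‖x n‖ ^ 2 + g (n + 2) * ‖x (n + 2)‖ ^ 2 := by
  have := norm_sq_add_le (hg (n + 1)).1 (sub_nonneg.2 (hg n).2) (hg (n + 1)).2 (g (n + 2))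
    (hg _).1 (x n) (x (n + 2))
  simpa [jacobiFun, chainCoeff] using this

/-- Summing the row estimates, |x_n|² collects weight 1 - g_n from row n + 1 and, for n ≥ 1, weight
g_n from row n - 1. The total never exceeds 1, which makes the matrix a contraction. -/
theorem summable_jacobiFun_and_tsum_le {g : ℕ → ℝ} (hg : ∀ n, g n ∈ Set.Icc (0 : ℝ) 1) {x : ℕ → ℂ}
    (hx : Summable fun n => ‖x n‖ ^ 2) :
    Summable (fun n => ‖jacobiFun (chainCoeff g) x n‖ ^ 2) ∧
      ∑' n, ‖jacobiFun (chainCoeff g) x n‖ ^ 2 ≤ ∑' n, ‖x n‖ ^ 2 := by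
  have hA : Summable fun n => (1 - g n) * ‖x n‖ ^ 2 :=
    hx.of_nonneg_of_le (fun n => mul_nonneg (sub_nonneg.2 (hg n).2) (by positivity))
      fun n => mul_le_of_le_one_left (by positivity) (by linarith [(hg n).1])
  have hB : Summable fun n => g n * ‖x n‖ ^ 2 :=
    hx.of_nonneg_of_le (fun n => mul_nonneg (hg n).1 (by positivity))
      fun n => mul_le_of_le_one_left (by positivity) (hg n).2
  have hB2 : Summable fun n => g (n + 2) * ‖x (n + 2)‖ ^ 2 := (summable_nat_add_iff 2).2 hB
  have hs : Summable (fun n => ‖jacobiFun (chainCoeff g) x n‖ ^ 2) := by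
    rw [← summable_nat_add_iff 1]
    exact (hA.add hB2).of_nonneg_of_le (fun n => by positivity) (norm_sq_jacobiFun_le hg x)
  refine ⟨hs, ?_⟩
  have h0 : ‖jacobiFun (chainCoeff g) x 0‖ ^ 2 ≤ g 1 * ‖x 1‖ ^ 2 := by
    have := norm_sq_add_le (hg 0).1 le_rfl (hg 0).2 (g 1) (hg 1).1 0 (x 1)
    simpa [jacobiFun, chainCoeff] using this
  rw [hs.tsum_eq_zero_add]
  have h1 := ((summable_nat_add_iff 1).2 hs).tsum_le_tsum (norm_sq_jacobiFun_le hg x) (hA.add hB2)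
  rw [hA.tsum_add hB2] at h1
  have h2 := hB.sum_add_tsum_nat_add 2
  simp only [Finset.sum_range_succ, Finset.sum_range_zero] at h2
  have h3 : ∑' n, ‖x n‖ ^ 2 = ∑' n, (1 - g n) * ‖x n‖ ^ 2 + ∑' n, g n * ‖x n‖ ^ 2 := by
    rw [← hA.tsum_add hB]; congr 1; ext n; ring
  have h4 : 0 ≤ g 0 * ‖x 0‖ ^ 2 := mul_nonneg (hg 0).1 (by positivity)
  linarith

theorem summable_norm_sq_lp (x : lp (fun _ : ℕ => ℂ) 2) : Summable fun n => ‖x n‖ ^ 2 := by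
  have := (lp.memℓp x).summable (by norm_num)
  simpa using this

theorem memℓp_two_of_summable {x : ℕ → ℂ} (hx : Summable fun n => ‖x n‖ ^ 2) :
    Memℓp x 2 := memℓp_gen (by simpa using hx)

theorem norm_sq_lp_two (x : lp (fun _ : ℕ => ℂ) 2) : ‖x‖ ^ 2 = ∑' n, ‖x n‖ ^ 2 := by
  have := lp.norm_rpow_eq_tsum (p := 2) (by norm_num) x
  simpa using this

/-- The Jacobi operator on `ℓ²` attached to a parameter sequence in `[0, 1]`. -/
noncomputable def jacobiOp (g : ℕ → ℝ) (hg : ∀ n, g n ∈ Set.Icc (0 : ℝ) 1) :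
    lp (fun _ : ℕ => ℂ) 2 →L[ℂ] lp (fun _ : ℕ => ℂ) 2 :=
  LinearMap.mkContinuous
    { toFun := fun x => ⟨jacobiFun (chainCoeff g) x,
        memℓp_two_of_summable (summable_jacobiFun_and_tsum_le hg (summable_norm_sq_lp x)).1⟩
      map_add' := by
        intro x y
        ext n
        change jacobiFun _ _ n = jacobiFun _ _ n + jacobiFun _ _ n
        cases n <;> simp [jacobiFun] <;> ring
      map_smul' := by
        intro r x
        ext n
        change jacobiFun _ _ n = r * jacobiFun _ _ n
        cases n <;> simp [jacobiFun] <;> ring } 1 (by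
    intro x
    rw [one_mul]
    refine le_of_sq_le_sq ?_ (norm_nonneg _)
    rw [norm_sq_lp_two, norm_sq_lp_two]
    exact (summable_jacobiFun_and_tsum_le hg (summable_norm_sq_lp x)).2)

theorem jacobiOp_apply (g : ℕ → ℝ) (hg : ∀ n, g n ∈ Set.Icc (0 : ℝ) 1)
    (x : lp (fun _ : ℕ => ℂ) 2) (n : ℕ) :
    jacobiOp g hg x n = jacobiFun (chainCoeff g) x n := rfl

theorem norm_jacobiOp_le (g : ℕ → ℝ) (hg : ∀ n, g n ∈ Set.Icc (0 : ℝ) 1) :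
    ‖jacobiOp g hg‖ ≤ 1 := LinearMap.mkContinuous_norm_le _ zero_le_one _

theorem norm_chainCoeff_le {g : ℕ → ℝ} (hg : ∀ n, g n ∈ Set.Icc (0 : ℝ) 1) (n : ℕ) :
    ‖chainCoeff g n‖ ≤ 1 := by
  rw [chainCoeff, Real.norm_of_nonneg (by positivity)]
  have h1 := hg (n - 1)
  have h2 := hg n
  exact Real.sqrt_le_one.2 (mul_le_one₀ (by linarith [h1.1]) h2.1 h2.2)

open scoped InnerProductSpace in
theorem isSelfAdjoint_jacobiOp (g : ℕ → ℝ) (hg : ∀ n, g n ∈ Set.Icc (0 : ℝ) 1) :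
    IsSelfAdjoint (jacobiOp g hg) := by
  rw [ContinuousLinearMap.isSelfAdjoint_iff_isSymmetric]
  intro x y
  simp only [ContinuousLinearMap.coe_coe]
  rw [lp.inner_eq_tsum, lp.inner_eq_tsum]
  simp only [jacobiOp_apply]
  set β := chainCoeff g
  have hmain : ∀ u v : lp (fun _ : ℕ => ℂ) 2,
      Summable fun n => (β (n + 1) : ℂ) * ((starRingEnd ℂ) (u n) * v (n + 1)) := by
    intro u v
    have hb : Summable fun n => ‖u n‖ ^ 2 + ‖v (n + 1)‖ ^ 2 :=
      (summable_norm_sq_lp u).add ((summable_nat_add_iff 1).2 (summable_norm_sq_lp v))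
    refine hb.of_norm_bounded fun n => ?_
    rw [norm_mul, norm_mul, Complex.norm_real, RCLike.norm_conj]
    have h1 := norm_chainCoeff_le hg (n + 1)
    have : ‖β (n + 1)‖ * (‖u n‖ * ‖v (n + 1)‖) ≤ ‖u n‖ * ‖v (n + 1)‖ :=
      mul_le_of_le_one_left (by positivity) h1
    nlinarith [sq_nonneg (‖u n‖ - ‖v (n + 1)‖), sq_nonneg (‖u n‖), sq_nonneg (‖v (n+1)‖)]
  have hmain' : ∀ u v : lp (fun _ : ℕ => ℂ) 2,
      Summable fun n => (β (n + 1) : ℂ) * ((starRingEnd ℂ) (u (n + 1)) * v n) := by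
    intro u v
    have := (hmain v u).map (starRingEnd ℂ) Complex.continuous_conj
    convert this using 2 with n
    simp [mul_comm]
  -- Both inner products split into the same two sums, one from the superdiagonal and one from the
  -- subdiagonal. The index shift is absorbed in row 0, which has a single neighbour.
  have key : ∀ (a b : ℕ → ℂ) (c : ℕ → ℂ), Summable a → Summable b →
      c 0 = b 0 → (∀ n, c (n + 1) = a n + b (n + 1)) → ∑' n, c n = ∑' n, a n + ∑' n, b n := by
    intro a b c ha hb h0 h
    have hc : Summable c := by
      rw [← summable_nat_add_iff 1]
      simp only [h]
      exact ha.add ((summable_nat_add_iff 1).2 hb)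
    rw [hc.tsum_eq_zero_add, hb.tsum_eq_zero_add, h0]
    simp only [h]
    rw [ha.tsum_add ((summable_nat_add_iff 1).2 hb)]
    ring
  rw [key _ _ _ (hmain x y) (hmain' x y), add_comm, ← key _ _ _ (hmain' x y) (hmain x y)]
  · simp [jacobiFun]; ring
  · intro n
    simp [jacobiFun]; ring
  · simp [jacobiFun]; ring
  · intro n
    simp [jacobiFun]; ring

/-! ### Heine's series: coefficient bounds and the contiguous relation. -/

/-- The real `q`-shifted factorial. -/
noncomputable def realWatson (a q : ℝ) (n : ℕ) : ℝ := ∏ k ∈ Finset.range n, (1 - a * q ^ k)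

theorem watsonSymbol_ofReal (a q : ℝ) (n : ℕ) :
    watsonSymbol (a : ℂ) (q : ℂ) n = (realWatson a q n : ℂ) := by
  simp [watsonSymbol, realWatson]

theorem realWatson_succ (a q : ℝ) (n : ℕ) :
    realWatson a q (n + 1) = realWatson a q n * (1 - a * q ^ n) := Finset.prod_range_succ _ _

theorem realWatson_succ' (a q : ℝ) (n : ℕ) :
    realWatson a q (n + 1) = (1 - a) * realWatson (a * q) q n := by
  rw [realWatson, Finset.prod_range_succ', mul_comm, realWatson]
  simp [pow_succ', mul_assoc]

/-- The Taylor coefficients of Heine's function. -/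
noncomputable def heineCoeff (a b c q : ℝ) (n : ℕ) : ℝ :=
  realWatson a q n * realWatson b q n / (realWatson c q n * realWatson q q n)

theorem heinePhi_ofReal (a b c q : ℝ) (z : ℂ) :
    heinePhi a b c q z = ∑' n : ℕ, (heineCoeff a b c q n : ℂ) * z ^ n := by
  simp [heinePhi, heineCoeff, watsonSymbol_ofReal]

theorem heineCoeff_symm (a b c q : ℝ) (n : ℕ) : heineCoeff a b c q n = heineCoeff b a c q n := by
  rw [heineCoeff, heineCoeff, mul_comm (realWatson a q n)]

theorem heinePhi_symm (a b c q : ℝ) (z : ℂ) : heinePhi a b c q z = heinePhi b a c q z := by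
  simp only [heinePhi_ofReal, heineCoeff_symm a b]

theorem realWatson_pos {c q : ℝ} (hq0 : 0 < q) (hq1 : q < 1) (hc0 : 0 ≤ c) (hc1 : c < 1) (n : ℕ) :
    0 < realWatson c q n := by
  refine Finset.prod_pos fun k _ => ?_
  have : q ^ k ≤ 1 := pow_le_one₀ hq0.le hq1.le
  nlinarith [mul_le_of_le_one_right hc0 this]

theorem realWatson_anti {a c q : ℝ} (hq0 : 0 < q) (hq1 : q < 1) (hac : a ≤ c) (hc0 : 0 ≤ c)
    (hc1 : c < 1) (n : ℕ) : realWatson c q n ≤ realWatson a q n := by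
  refine Finset.prod_le_prod (fun k _ => ?_) fun k _ => ?_
  · have : q ^ k ≤ 1 := pow_le_one₀ hq0.le hq1.le
    nlinarith [mul_le_of_le_one_right hc0 this]
  · have : 0 < q ^ k := by positivity
    nlinarith

theorem abs_realWatson_le_one {a q : ℝ} (hq0 : 0 < q) (hq1 : q < 1) (ha0 : 0 ≤ a) (ha1 : a ≤ 1)
    (n : ℕ) : |realWatson a q n| ≤ 1 := by
  rw [realWatson, Finset.abs_prod]
  refine Finset.prod_le_one (fun _ _ => abs_nonneg _) fun k _ => ?_
  have h1 : q ^ k ≤ 1 := pow_le_one₀ hq0.le hq1.le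
  have h2 : 0 < q ^ k := by positivity
  rw [abs_le]
  constructor <;> nlinarith

/-- Here b may exceed 1, but only the first factor 1 - b is then large; the remaining ones form the
symbol of bq ≤ 1. -/
theorem abs_realWatson_le_inv {b q : ℝ} (hq0 : 0 < q) (hq1 : q < 1) (hb0 : 0 ≤ b)
    (hb1 : q * b ≤ 1) (n : ℕ) : |realWatson b q n| ≤ 1 / q := by
  have hq : 1 ≤ 1 / q := by rw [le_div_iff₀ hq0]; linarith
  cases n with
  | zero => simpa [realWatson] using hq
  | succ n =>
    rw [realWatson_succ', abs_mul]
    have h1 := abs_realWatson_le_one hq0 hq1 (by positivity) (by linarith : b * q ≤ 1) n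
    have h2 : |1 - b| ≤ 1 / q := by
      have : b ≤ 1 / q := by rw [le_div_iff₀ hq0]; linarith
      rw [abs_le]; constructor <;> linarith
    calc _ ≤ 1 / q * 1 := mul_le_mul h2 h1 (abs_nonneg _) (by positivity)
      _ = 1 / q := mul_one _

/-- The parameter region of Heine's function which is stable under `heineShift`. -/
structure HeineAdmissible (q : ℝ) (p : ℝ × ℝ × ℝ) : Prop where
  c_nonneg : 0 ≤ p.2.2
  c_lt_one : p.2.2 < 1
  c_le_a : p.2.2 ≤ p.1
  a_le_one : p.1 ≤ 1
  c_le_b : p.2.2 ≤ p.2.1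
  b_le : q * p.2.1 ≤ 1

/-- The parameter shift along Heine's continued fraction. -/
def heineShift (q : ℝ) (p : ℝ × ℝ × ℝ) : ℝ × ℝ × ℝ := (p.2.1 * q, p.1, p.2.2 * q)

theorem HeineAdmissible.shift {q : ℝ} (hq0 : 0 < q) (hq1 : q < 1) {p : ℝ × ℝ × ℝ}
    (h : HeineAdmissible q p) : HeineAdmissible q (heineShift q p) := by
  obtain ⟨a, b, c⟩ := p
  obtain ⟨h1, h2, h3, h4, h5, h6⟩ := h
  simp only at h1 h2 h3 h4 h5 h6
  constructor <;> simp only [heineShift] <;> nlinarith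

theorem HeineAdmissible.iterate {q : ℝ} (hq0 : 0 < q) (hq1 : q < 1) {p : ℝ × ℝ × ℝ}
    (h : HeineAdmissible q p) (n : ℕ) : HeineAdmissible q ((heineShift q)^[n] p) := by
  induction n with
  | zero => exact h
  | succ n ih => rw [Function.iterate_succ_apply']; exact ih.shift hq0 hq1

/-- The free bound `c` makes the majorant independent of the parameters: since the third parameter
decreases under the shift, one `c` serves the whole orbit. -/
theorem HeineAdmissible.abs_coeff_le {q : ℝ} (hq0 : 0 < q) (hq1 : q < 1) {p : ℝ × ℝ × ℝ}
    (h : HeineAdmissible q p) {c : ℝ} (hc : p.2.2 ≤ c) (hc1 : c < 1) (n : ℕ) :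
    |heineCoeff p.1 p.2.1 p.2.2 q n| ≤ 1 / q * (1 / (realWatson c q n * realWatson q q n)) := by
  have h0 := h.c_nonneg
  have hA := abs_realWatson_le_one hq0 hq1 (h0.trans h.c_le_a) h.a_le_one n
  have hB := abs_realWatson_le_inv hq0 hq1 (h0.trans h.c_le_b) h.b_le n
  have hC := realWatson_anti hq0 hq1 hc (h0.trans hc) hc1 n
  have hC0 := realWatson_pos hq0 hq1 (h0.trans hc) hc1 n
  have hQ := realWatson_pos hq0 hq1 hq0.le hq1 n
  rw [heineCoeff, abs_div, abs_mul, abs_of_pos (mul_pos (hC0.trans_le hC) hQ), mul_one_div]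
  gcongr
  calc _ ≤ 1 * (1 / q) := mul_le_mul hA hB (abs_nonneg _) zero_le_one
    _ = 1 / q := one_mul _

theorem summable_heine_majorant {q c r : ℝ} (hq0 : 0 < q) (hq1 : q < 1) (hc0 : 0 ≤ c)
    (hc1 : c < 1) (hr0 : 0 ≤ r) (hr1 : r < 1) :
    Summable fun n => 1 / q * (1 / (realWatson c q n * realWatson q q n)) * r ^ n := by
  rcases hr0.eq_or_lt with rfl | hr0
  · exact summable_of_ne_finset_zero (s := {0}) fun n hn => by
      simp at hn; simp [hn]
  have hpos : ∀ n, 0 < realWatson c q n * realWatson q q n := fun n =>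
    mul_pos (realWatson_pos hq0 hq1 hc0 hc1 n) (realWatson_pos hq0 hq1 hq0.le hq1 n)
  refine summable_of_ratio_test_tendsto_lt_one (l := r) hr1
    (Filter.Eventually.of_forall fun n => ?_) ?_
  · have := hpos n
    positivity
  · have hlim : Filter.Tendsto (fun n : ℕ => r / ((1 - c * q ^ n) * (1 - q * q ^ n)))
        Filter.atTop (nhds (r / ((1 - c * 0) * (1 - q * 0)))) := by
      have hqn := tendsto_pow_atTop_nhds_zero_of_lt_one hq0.le hq1
      refine Filter.Tendsto.div tendsto_const_nhds ?_ (by simp)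
      exact (tendsto_const_nhds.sub (tendsto_const_nhds.mul hqn)).mul
        (tendsto_const_nhds.sub (tendsto_const_nhds.mul hqn))
    simp only [mul_zero, sub_zero, mul_one, div_one] at hlim
    refine hlim.congr fun n => ?_
    have h1 := hpos n
    have h2 := hpos (n + 1)
    rw [Real.norm_of_nonneg (by positivity), Real.norm_of_nonneg (by positivity)]
    rw [realWatson_succ, realWatson_succ] at h2 ⊢
    have a1 : realWatson c q n ≠ 0 := (realWatson_pos hq0 hq1 hc0 hc1 n).ne'
    have a2 : realWatson q q n ≠ 0 := (realWatson_pos hq0 hq1 hq0.le hq1 n).ne'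
    have a3 : 1 - c * q ^ n ≠ 0 := by
      intro h; rw [h] at h2; simp at h2
    have a4 : 1 - q * q ^ n ≠ 0 := by
      intro h; rw [h] at h2; simp at h2
    field_simp
    ring

/-- Heine's function at a parameter triple. -/
noncomputable def heineAt (q : ℝ) (p : ℝ × ℝ × ℝ) (z : ℂ) : ℂ :=
  heinePhi p.1 p.2.1 p.2.2 q z

theorem HeineAdmissible.norm_term_le {q : ℝ} (hq0 : 0 < q) (hq1 : q < 1) {p : ℝ × ℝ × ℝ}
    (h : HeineAdmissible q p) {c : ℝ} (hc : p.2.2 ≤ c) (hc1 : c < 1) (z : ℂ) (n : ℕ) :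
    ‖(heineCoeff p.1 p.2.1 p.2.2 q n : ℂ) * z ^ n‖ ≤
      1 / q * (1 / (realWatson c q n * realWatson q q n)) * ‖z‖ ^ n := by
  rw [norm_mul, norm_pow, Complex.norm_real]
  exact mul_le_mul_of_nonneg_right (h.abs_coeff_le hq0 hq1 hc hc1 n) (by positivity)

theorem HeineAdmissible.summable {q : ℝ} (hq0 : 0 < q) (hq1 : q < 1) {p : ℝ × ℝ × ℝ}
    (h : HeineAdmissible q p) {z : ℂ} (hz : ‖z‖ < 1) :
    Summable fun n => (heineCoeff p.1 p.2.1 p.2.2 q n : ℂ) * z ^ n :=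
  (summable_heine_majorant hq0 hq1 h.c_nonneg h.c_lt_one (norm_nonneg z) hz).of_norm_bounded
    (h.norm_term_le hq0 hq1 le_rfl h.c_lt_one z)

/-- The coefficient in the contiguous relation of Heine. -/
noncomputable def heineStep (q : ℝ) (p : ℝ × ℝ × ℝ) : ℝ :=
  (p.2.1 - p.2.2) * (1 - p.1) / ((1 - p.2.2) * (1 - p.2.2 * q))

theorem heineCoeff_contiguous {q a b c : ℝ} (hq0 : 0 < q) (hq1 : q < 1) (hc0 : 0 ≤ c)
    (hc1 : c < 1) (n : ℕ) :
    heineCoeff (b * q) a (c * q) q (n + 1) = heineCoeff a b c q (n + 1) +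
      (b - c) * (1 - a) / ((1 - c) * (1 - c * q)) * heineCoeff (a * q) (b * q) (c * q * q) q n := by
  have hcq : c * q < 1 := by nlinarith
  -- The two ways of peeling a factor off (cq;q)_{n+1} express (cq²;q)_n through (cq;q)_n, leaving a
  -- rational identity in q^n.
  have hZ := realWatson_succ (c * q) q n
  rw [realWatson_succ'] at hZ
  have hQ := (realWatson_pos hq0 hq1 hq0.le hq1 n).ne'
  have hZ0 := (realWatson_pos hq0 hq1 (mul_nonneg hc0 hq0.le) hcq n).ne'
  have hW0 := (realWatson_pos hq0 hq1 (mul_nonneg (mul_nonneg hc0 hq0.le) hq0.le)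
    (by nlinarith : c * q * q < 1) n).ne'
  have hqn : q * q ^ n < 1 := by
    have := pow_lt_one₀ hq0.le hq1 (Nat.succ_ne_zero n)
    rwa [pow_succ'] at this
  have hqn0 : 0 < q * q ^ n := by positivity
  have e1 : 1 - q * q ^ n ≠ 0 := by linarith
  have e2 : 1 - c * q * q ^ n ≠ 0 := by nlinarith
  have e3 : 1 - c ≠ 0 := by linarith
  have e4 : 1 - c * q ≠ 0 := by linarith
  have hW : realWatson (c * q * q) q n = realWatson (c * q) q n * (1 - c * q * q ^ n) / (1 - c * q) := by
    rw [← hZ]; field_simp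
  rw [heineCoeff, heineCoeff, heineCoeff, hW, realWatson_succ (b * q), realWatson_succ' a,
    realWatson_succ (c * q), realWatson_succ q, realWatson_succ' b, realWatson_succ' c]
  generalize realWatson (c * q) q n = Z at *
  generalize realWatson (a * q) q n = X at *
  generalize realWatson (b * q) q n = Y at *
  generalize realWatson q q n = Q at *
  clear hW hZ hW0 hqn hqn0
  generalize q ^ n = t at *
  have e5 : 1 - q * t * c ≠ 0 := by convert e2 using 1; ring
  have e6 : 1 - q * c ≠ 0 := by convert e4 using 1; ring
  field_simp
  ring

theorem heineAt_eq (q : ℝ) (p : ℝ × ℝ × ℝ) (z : ℂ) :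
    heineAt q p z = ∑' n : ℕ, (heineCoeff p.1 p.2.1 p.2.2 q n : ℂ) * z ^ n := heinePhi_ofReal _ _ _ _ _

theorem HeineAdmissible.contiguous {q : ℝ} (hq0 : 0 < q) (hq1 : q < 1) {p : ℝ × ℝ × ℝ}
    (h : HeineAdmissible q p) {z : ℂ} (hz : ‖z‖ < 1) :
    heineAt q (heineShift q p) z =
      heineAt q p z + heineStep q p * z * heineAt q (heineShift q (heineShift q p)) z := by
  have h1 := h.shift hq0 hq1
  have s0 := h.summable hq0 hq1 hz
  have s1 := h1.summable hq0 hq1 hz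
  have s2 := (h1.shift hq0 hq1).summable hq0 hq1 hz
  rw [heineAt_eq, heineAt_eq, heineAt_eq, s1.tsum_eq_zero_add, s0.tsum_eq_zero_add, add_assoc,
    ← tsum_mul_left, ← ((summable_nat_add_iff 1).2 s0).tsum_add (s2.mul_left _)]
  refine congrArg₂ (· + ·) (by simp [heineCoeff, realWatson]) ?_
  · congr 1
    ext n
    obtain ⟨a, b, c⟩ := p
    simp only [heineShift, heineStep]
    rw [heineCoeff_contiguous hq0 hq1 h.c_nonneg h.c_lt_one n]
    push_cast
    ring

theorem HeineAdmissible.exists_bound {q : ℝ} (hq0 : 0 < q) (hq1 : q < 1) {p : ℝ × ℝ × ℝ}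
    (h : HeineAdmissible q p) {z : ℂ} (hz : ‖z‖ < 1) :
    ∃ C : ℝ, ∀ n, ‖heineAt q ((heineShift q)^[n] p) z‖ ≤ C := by
  refine ⟨∑' n, 1 / q * (1 / (realWatson p.2.2 q n * realWatson q q n)) * ‖z‖ ^ n, fun n => ?_⟩
  rw [heineAt_eq]
  have hc : ((heineShift q)^[n] p).2.2 ≤ p.2.2 := by
    induction n with
    | zero => simp
    | succ n ih =>
      rw [Function.iterate_succ_apply']
      exact (mul_le_of_le_one_right (h.iterate hq0 hq1 n).c_nonneg hq1.le).trans ih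
  exact tsum_of_norm_bounded
    (summable_heine_majorant hq0 hq1 h.c_nonneg h.c_lt_one (norm_nonneg z) hz).hasSum
    ((h.iterate hq0 hq1 n).norm_term_le hq0 hq1 hc h.c_lt_one z)

theorem one_sub_ofReal_mul_ne_zero {q : ℝ} (hq0 : 0 < q) {z : ℂ} (hz : z ∈ cutPlane q) :
    ∀ t ∈ Set.Icc (0 : ℝ) 1, 1 - (t : ℂ) * (z / q) ≠ 0 := by
  intro t ht h
  have hq : (q : ℂ) ≠ 0 := by exact_mod_cast hq0.ne'
  have ht0 : t ≠ 0 := by rintro rfl; simp at h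
  have ht' : (t : ℂ) ≠ 0 := by exact_mod_cast ht0
  refine hz ⟨q / t, ?_, ?_⟩
  · have : 0 < t := lt_of_le_of_ne ht.1 ht0.symm
    rw [le_div_iff₀ this]
    nlinarith [ht.2]
  · push_cast
    field_simp at h ⊢
    linear_combination -h

/-! ### The continued fraction as a Stieltjes transform. -/

/-- The parameters of the chain sequence of Heine's continued fraction. -/
noncomputable def heineChain (q : ℝ) (p : ℝ × ℝ × ℝ) (n : ℕ) : ℝ :=
  (((heineShift q)^[n] p).1 - ((heineShift q)^[n] p).2.2) / (1 - ((heineShift q)^[n] p).2.2)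

theorem HeineAdmissible.chain_mem {q : ℝ} (hq0 : 0 < q) (hq1 : q < 1) {p : ℝ × ℝ × ℝ}
    (h : HeineAdmissible q p) (n : ℕ) : heineChain q p n ∈ Set.Icc (0 : ℝ) 1 := by
  have hn := h.iterate hq0 hq1 n
  have h1 := hn.c_lt_one
  have h2 := hn.c_le_a
  have h3 := hn.a_le_one
  rw [heineChain]
  exact ⟨div_nonneg (by linarith) (by linarith), (div_le_one (by linarith)).2 (by linarith)⟩

/-- Here 1 - g_n = (1 - a)/(1 - c) and g_{n+1} = q(b - c)/(1 - cq) at the n-th parameters. This puts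
the continued fraction in chain-sequence form. -/
theorem HeineAdmissible.chain_mul {q : ℝ} (hq0 : 0 < q) (hq1 : q < 1) {p : ℝ × ℝ × ℝ}
    (h : HeineAdmissible q p) (n : ℕ) :
    (1 - heineChain q p n) * heineChain q p (n + 1) =
      q * heineStep q ((heineShift q)^[n] p) := by
  have hn := h.iterate hq0 hq1 n
  simp only [heineChain, Function.iterate_succ_apply', heineStep]
  generalize (heineShift q)^[n] p = p' at *
  obtain ⟨a, b, c⟩ := p'
  have h1 := hn.c_lt_one
  have h2 := (hn.shift hq0 hq1).c_lt_one
  simp only [heineShift] at *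
  have e1 : 1 - c ≠ 0 := by linarith
  have e2 : 1 - c * q ≠ 0 := by linarith
  have e3 : 1 - q * c ≠ 0 := by linarith
  field_simp
  ring

/-- Two shifts multiply a and b by q, so one shift costs a factor √q; weighting b by √q makes the
induction close. -/
theorem HeineAdmissible.iterate_le {q : ℝ} (hq0 : 0 < q) (hq1 : q < 1) {p : ℝ × ℝ × ℝ}
    (h : HeineAdmissible q p) (n : ℕ) :
    ((heineShift q)^[n] p).1 ≤ √q ^ n / √q ∧ √q * ((heineShift q)^[n] p).2.1 ≤ √q ^ n / √q := by
  have hs : 0 < √q := Real.sqrt_pos.2 hq0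
  have hs2 : √q * √q = q := Real.mul_self_sqrt hq0.le
  have hs1 : √q ≤ 1 := Real.sqrt_le_one.2 hq1.le
  induction n with
  | zero =>
    have h1 := h.a_le_one
    have h2 := h.b_le
    simp only [Function.iterate_zero, id, pow_zero]
    rw [le_div_iff₀ hs, le_div_iff₀ hs]
    refine ⟨?_, ?_⟩
    · have := h.c_nonneg.trans h.c_le_a
      nlinarith
    · rw [← hs2] at h2; linarith
  | succ n ih =>
    rw [Function.iterate_succ_apply']
    simp only [heineShift, le_div_iff₀ hs] at ih ⊢
    rw [pow_succ]
    constructor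
    · calc _ = √q * ((heineShift q)^[n] p).2.1 * √q * √q := by
            nth_rewrite 2 [← hs2]; ring
        _ ≤ _ := mul_le_mul_of_nonneg_right ih.2 hs.le
    · nlinarith [ih.1]

theorem HeineAdmissible.tendsto_iterate {q : ℝ} (hq0 : 0 < q) (hq1 : q < 1) {p : ℝ × ℝ × ℝ}
    (h : HeineAdmissible q p) :
    Filter.Tendsto (fun n => ((heineShift q)^[n] p).1) Filter.atTop (nhds 0) ∧
    Filter.Tendsto (fun n => ((heineShift q)^[n] p).2.1) Filter.atTop (nhds 0) ∧
    Filter.Tendsto (fun n => ((heineShift q)^[n] p).2.2) Filter.atTop (nhds 0) := by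
  have hs : 0 < √q := Real.sqrt_pos.2 hq0
  have hs1 : √q < 1 := by rw [Real.sqrt_lt' one_pos]; simpa using hq1
  have hlim : Filter.Tendsto (fun n : ℕ => √q ^ n / √q) Filter.atTop (nhds 0) := by
    simpa using (tendsto_pow_atTop_nhds_zero_of_lt_one hs.le hs1).div_const √q
  have hA := squeeze_zero (fun n => (h.iterate hq0 hq1 n).c_nonneg.trans (h.iterate hq0 hq1 n).c_le_a)
    (fun n => (h.iterate_le hq0 hq1 n).1) hlim
  refine ⟨hA, ?_, ?_⟩
  · rw [← Filter.tendsto_add_atTop_iff_nat 1]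
    simp only [Function.iterate_succ_apply']
    exact hA
  · exact squeeze_zero (fun n => (h.iterate hq0 hq1 n).c_nonneg)
      (fun n => (h.iterate hq0 hq1 n).c_le_a) hA

theorem HeineAdmissible.tendsto_chain {q : ℝ} (hq0 : 0 < q) (hq1 : q < 1) {p : ℝ × ℝ × ℝ}
    (h : HeineAdmissible q p) :
    Filter.Tendsto (heineChain q p) Filter.atTop (nhds 0) := by
  obtain ⟨hA, -, hC⟩ := h.tendsto_iterate hq0 hq1
  have := (hA.sub hC).div (tendsto_const_nhds.sub hC) (by simp : (1 : ℝ) - 0 ≠ 0)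
  rw [sub_zero, zero_div] at this
  exact this

/-- The decay of the entries puts the solution of the recurrence in ℓ². -/
theorem HeineAdmissible.tendsto_chainCoeff {q : ℝ} (hq0 : 0 < q) (hq1 : q < 1) {p : ℝ × ℝ × ℝ}
    (h : HeineAdmissible q p) :
    Filter.Tendsto (chainCoeff (heineChain q p)) Filter.atTop (nhds 0) := by
  rw [← Filter.tendsto_add_atTop_iff_nat 1]
  refine squeeze_zero (fun n => Real.sqrt_nonneg _) (fun n => Real.sqrt_le_sqrt
    (?_ : _ ≤ heineChain q p (n + 1))) ?_
  · exact mul_le_of_le_one_left (h.chain_mem hq0 hq1 _).1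
      (by linarith [(h.chain_mem hq0 hq1 (n + 1 - 1)).1])
  · have := (Real.continuous_sqrt.tendsto 0).comp
      ((Filter.tendsto_add_atTop_iff_nat 1).2 (h.tendsto_chain hq0 hq1))
    simpa [Function.comp_def] using this

/-- The solution of the three-term recurrence attached to Heine's continued fraction. -/
theorem HeineAdmissible.exists_solution {q : ℝ} (hq0 : 0 < q) (hq1 : q < 1) {p : ℝ × ℝ × ℝ}
    (h : HeineAdmissible q p) {z s : ℂ} (hz : ‖z‖ < 1) (hs : s ^ 2 = z / q) :
    ∃ U : lp (fun _ : ℕ => ℂ) 2, U 0 = heineAt q (heineShift q p) z ∧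
      U - s • jacobiOp (heineChain q p) (h.chain_mem hq0 hq1) U =
        heineAt q p z • lp.single 2 0 (1 : ℂ) := by
  set β := chainCoeff (heineChain q p) with hβ
  -- This scaling turns the contiguous recurrence into the symmetric one of the Jacobi matrix: the
  -- square of the (n+1)-st factor is z d_n.
  let P : ℕ → ℂ := fun n => ∏ i ∈ Finset.range n, s * β (i + 1)
  have hP : ∀ n, P (n + 1) = P n * (s * β (n + 1)) := fun n => Finset.prod_range_succ _ _
  obtain ⟨C, hC⟩ := h.exists_bound hq0 hq1 hz
  have hPs : Summable fun n => ‖P n‖ ^ 2 := by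
    have hlim : Filter.Tendsto (fun n => ‖s * (β (n + 1) : ℂ)‖ ^ 2) Filter.atTop (nhds 0) := by
      have h1 := (Filter.tendsto_add_atTop_iff_nat 1).2 (h.tendsto_chainCoeff hq0 hq1)
      have h2 := ((((Complex.continuous_ofReal.tendsto 0).comp h1).const_mul s).norm).pow 2
      simpa [Function.comp_def] using h2
    have hev := hlim.eventually (ge_mem_nhds (show (0 : ℝ) < 1 / 2 by norm_num))
    refine summable_of_ratio_norm_eventually_le (r := 1 / 2) (by norm_num) ?_
    filter_upwards [hev] with n hn
    rw [hP, norm_mul, mul_pow, norm_mul, mul_comm (1 / 2 : ℝ)]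
    simp only [norm_pow, norm_norm]
    exact mul_le_mul_of_nonneg_left hn (by positivity)
  let u : ℕ → ℂ := fun n => P n * heineAt q ((heineShift q)^[n + 1] p) z
  have hu : Summable fun n => ‖u n‖ ^ 2 := by
    refine (hPs.mul_right (C ^ 2)).of_nonneg_of_le (fun n => by positivity) fun n => ?_
    rw [norm_mul, mul_pow]
    have := hC (n + 1)
    gcongr
  have hstep : ∀ n, s * β (n + 1) * (s * β (n + 1)) = z * heineStep q ((heineShift q)^[n] p) := by
    intro n
    have h1 : (β (n + 1)) ^ 2 = q * heineStep q ((heineShift q)^[n] p) := by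
      rw [← h.chain_mul hq0 hq1 n, hβ, chainCoeff, Real.sq_sqrt]
      · simp
      · exact mul_nonneg (by linarith [(h.chain_mem hq0 hq1 (n + 1 - 1)).2])
          (h.chain_mem hq0 hq1 _).1
    have h2 : (β (n + 1) : ℂ) ^ 2 = q * heineStep q ((heineShift q)^[n] p) := by
      exact_mod_cast congrArg (fun x : ℝ => (x : ℂ)) h1
    have hq : (q : ℂ) ≠ 0 := by exact_mod_cast hq0.ne'
    calc _ = s ^ 2 * (β (n + 1) : ℂ) ^ 2 := by ring
      _ = _ := by rw [hs, h2]; field_simp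
  have hrec : ∀ n, heineAt q ((heineShift q)^[n + 1] p) z =
      heineAt q ((heineShift q)^[n] p) z +
        s * β (n + 1) * (s * β (n + 1)) * heineAt q ((heineShift q)^[n + 2] p) z := by
    intro n
    rw [hstep]
    have := (h.iterate hq0 hq1 n).contiguous hq0 hq1 hz
    rw [Function.iterate_succ_apply', Function.iterate_succ_apply', Function.iterate_succ_apply',
      this]
    ring
  refine ⟨⟨u, memℓp_two_of_summable hu⟩, by simp [u, P], ?_⟩
  ext n
  change u n - s * jacobiFun β u n = heineAt q p z * _
  cases n with
  | zero =>
    have := hrec 0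
    simp only [zero_add, Function.iterate_zero, id, Function.iterate_one] at this
    simp [jacobiFun, u, P, this]
    ring
  | succ n =>
    have := hrec (n + 1)
    simp only [jacobiFun, u, hP] at this ⊢
    rw [this]
    simp
    ring

/-- Heine's continued fraction as a Stieltjes transform. -/
theorem HeineAdmissible.exists_measure {q : ℝ} (hq0 : 0 < q) (hq1 : q < 1) {p : ℝ × ℝ × ℝ}
    (h : HeineAdmissible q p) :
    ∃ ν : Measure ℝ, IsProbabilityMeasure ν ∧ (∀ᵐ t ∂ν, t ∈ Set.Icc (0 : ℝ) 1) ∧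
      ∀ z : ℂ, ‖z‖ < 1 → z ∈ cutPlane q →
        heineAt q (heineShift q p) z =
          heineAt q p z * ∫ t : ℝ, 1 / (1 - (t : ℂ) * (z / q)) ∂ν := by
  set T := jacobiOp (heineChain q p) (h.chain_mem hq0 hq1) with hT
  obtain ⟨ν, hν, hν1, H⟩ := exists_spectralMeasure_sq T (isSelfAdjoint_jacobiOp _ _)
    (norm_jacobiOp_le _ _) (lp.single 2 0 (1 : ℂ)) (by simp)
  refine ⟨ν, hν, hν1, fun z hz hzc => ?_⟩
  obtain ⟨s, hs⟩ := IsAlgClosed.exists_pow_nat_eq (z / q) (n := 2) (by norm_num)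
  obtain ⟨U, hU0, hU⟩ := h.exists_solution hq0 hq1 hz hs
  -- Applying 1 + sJ to the equation for s and 1 - sJ to the one for -s gives right-hand sides F_0(e
  -- ± sJe). In the sum the Je terms cancel, leaving an equation in J² alone.
  obtain ⟨W, hW0, hW⟩ := h.exists_solution hq0 hq1 (s := -s) hz (by rw [neg_sq, hs])
  rw [← hT] at hU hW
  have := H (z / q) (one_sub_ofReal_mul_ne_zero hq0 hzc) (U + W) (2 * heineAt q p z) (by
    have h1 : U + W - (z / q) • T (T (U + W)) =
        ((U - s • T U) + s • T (U - s • T U)) + ((W - (-s) • T W) + (-s) • T (W - (-s) • T W)) := by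
      rw [← hs]
      simp only [map_sub, map_add, map_smul]
      module
    rw [h1, hU, hW, map_smul]
    module)
  rw [lp.inner_single_left] at this
  have h2 : (U + W : lp (fun _ : ℕ => ℂ) 2) 0 = U 0 + W 0 := rfl
  rw [h2, hU0, hW0] at this
  simp only [RCLike.inner_apply, map_one, mul_one] at this
  linear_combination this / 2

/-! ### Absence of zeros in the cut disk. -/

theorem heineAdmissible_zero (q : ℝ) : HeineAdmissible q (0, 0, 0) := by
  constructor <;> simp

theorem realWatson_zero (q : ℝ) (n : ℕ) : realWatson 0 q n = 1 := by simp [realWatson]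

theorem heineCoeff_zero (q : ℝ) (n : ℕ) : heineCoeff 0 0 0 q n = 1 / realWatson q q n := by
  simp [heineCoeff, realWatson_zero]

/-- The functional equation of 1/∏(1 - zq^k), read off from the coefficients 1/(q;q)_n. -/
theorem heineAt_zero_mul {q : ℝ} (hq0 : 0 < q) (hq1 : q < 1) {z : ℂ} (hz : ‖z‖ < 1) :
    heineAt q (0, 0, 0) (q * z) = (1 - z) * heineAt q (0, 0, 0) z := by
  have hqz : ‖(q : ℂ) * z‖ < 1 := by
    rw [norm_mul, Complex.norm_real, Real.norm_of_nonneg hq0.le]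
    nlinarith [norm_nonneg z]
  have s0 := (heineAdmissible_zero q).summable hq0 hq1 hz
  have s1 := (heineAdmissible_zero q).summable hq0 hq1 hqz
  rw [heineAt_eq, heineAt_eq, sub_mul, one_mul]
  rw [s1.tsum_eq_zero_add]
  nth_rewrite 1 [s0.tsum_eq_zero_add]
  rw [← tsum_mul_left, add_sub_assoc, ← ((summable_nat_add_iff 1).2 s0).tsum_sub (s0.mul_left _)]
  refine congrArg₂ (· + ·) (by simp) (tsum_congr fun n => ?_)
  simp only [heineCoeff_zero, realWatson_succ]
  have h1 : (realWatson q q n : ℂ) ≠ 0 := by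
    exact_mod_cast (realWatson_pos hq0 hq1 hq0.le hq1 n).ne'
  have h2 : (1 - q * q ^ n : ℂ) ≠ 0 := by
    have := pow_lt_one₀ hq0.le hq1 (Nat.succ_ne_zero n)
    rw [pow_succ'] at this
    exact_mod_cast (sub_pos.2 this).ne'
  push_cast
  field_simp
  ring

theorem HeineAdmissible.norm_term_le_of_le {q : ℝ} (hq0 : 0 < q) (hq1 : q < 1) {p : ℝ × ℝ × ℝ}
    (h : HeineAdmissible q p) {z w : ℂ} (hw : ‖w‖ ≤ ‖z‖) (n : ℕ) :
    ‖(heineCoeff p.1 p.2.1 p.2.2 q n : ℂ) * w ^ n‖ ≤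
      1 / q * (1 / (realWatson p.2.2 q n * realWatson q q n)) * ‖z‖ ^ n := by
  refine (h.norm_term_le hq0 hq1 le_rfl h.c_lt_one w n).trans ?_
  have h1 := realWatson_pos hq0 hq1 h.c_nonneg h.c_lt_one n
  have h2 := realWatson_pos hq0 hq1 hq0.le hq1 n
  gcongr

/-- By the functional equation a zero z propagates to every q^n z, contradicting the value 1 at the
limit point 0. -/
theorem heineAt_zero_ne_zero {q : ℝ} (hq0 : 0 < q) (hq1 : q < 1) {z : ℂ} (hz : ‖z‖ < 1) :
    heineAt q (0, 0, 0) z ≠ 0 := by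
  intro h0
  have hn : ∀ n : ℕ, ‖(q : ℂ) ^ n * z‖ ≤ ‖z‖ := by
    intro n
    rw [norm_mul, norm_pow, Complex.norm_real, Real.norm_of_nonneg hq0.le]
    exact mul_le_of_le_one_left (norm_nonneg z) (pow_le_one₀ hq0.le hq1.le)
  have hzero : ∀ n : ℕ, heineAt q (0, 0, 0) ((q : ℂ) ^ n * z) = 0 := by
    intro n
    induction n with
    | zero => simpa using h0
    | succ n ih =>
      rw [pow_succ', mul_assoc, heineAt_zero_mul hq0 hq1 ((hn n).trans_lt hz), ih, mul_zero]
  have hlim : Filter.Tendsto (fun n : ℕ => heineAt q (0, 0, 0) ((q : ℂ) ^ n * z)) Filter.atTop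
      (nhds (heineAt q (0, 0, 0) 0)) := by
    simp only [heineAt_eq]
    refine tendsto_tsum_of_dominated_convergence
      (summable_heine_majorant hq0 hq1 le_rfl zero_lt_one (norm_nonneg z) hz) (fun k => ?_)
      (Filter.Eventually.of_forall fun n k =>
        (heineAdmissible_zero q).norm_term_le_of_le hq0 hq1 (hn n) k)
    have h1 : Filter.Tendsto (fun n : ℕ => (q : ℂ) ^ n * z) Filter.atTop (nhds 0) := by
      have : Filter.Tendsto (fun n : ℕ => (q : ℂ) ^ n) Filter.atTop (nhds 0) :=
        tendsto_pow_atTop_nhds_zero_of_norm_lt_one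
          (by rwa [Complex.norm_real, Real.norm_of_nonneg hq0.le])
      simpa using this.mul_const z
    exact (h1.pow k).const_mul _
  simp only [hzero] at hlim
  have h1 : heineAt q (0, 0, 0) 0 = 1 := by
    rw [heineAt_eq, tsum_eq_single 0]
    · simp [heineCoeff_zero, realWatson]
    · intro n hn; simp [hn]
  rw [h1] at hlim
  exact zero_ne_one (tendsto_nhds_unique tendsto_const_nhds hlim)

theorem tendsto_realWatson {u : ℕ → ℝ} (hu : Filter.Tendsto u Filter.atTop (nhds 0)) (q : ℝ)
    (k : ℕ) : Filter.Tendsto (fun n => realWatson (u n) q k) Filter.atTop (nhds 1) := by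
  have : Filter.Tendsto (fun n => realWatson (u n) q k) Filter.atTop
      (nhds (∏ i ∈ Finset.range k, (1 - 0 * q ^ i))) :=
    tendsto_finsetProd _ fun i _ => tendsto_const_nhds.sub (hu.mul_const _)
  simpa using this

theorem HeineAdmissible.iterate_c_le {q : ℝ} (hq0 : 0 < q) (hq1 : q < 1) {p : ℝ × ℝ × ℝ}
    (h : HeineAdmissible q p) (n : ℕ) : ((heineShift q)^[n] p).2.2 ≤ p.2.2 := by
  induction n with
  | zero => simp
  | succ n ih =>
    rw [Function.iterate_succ_apply']
    exact (mul_le_of_le_one_right (h.iterate hq0 hq1 n).c_nonneg hq1.le).trans ih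

/-- Dominated convergence: all three parameters tend to 0 along the orbit, under the uniform
majorant. -/
theorem HeineAdmissible.tendsto_heineAt {q : ℝ} (hq0 : 0 < q) (hq1 : q < 1) {p : ℝ × ℝ × ℝ}
    (h : HeineAdmissible q p) {z : ℂ} (hz : ‖z‖ < 1) :
    Filter.Tendsto (fun n => heineAt q ((heineShift q)^[n] p) z) Filter.atTop
      (nhds (heineAt q (0, 0, 0) z)) := by
  obtain ⟨hA, hB, hC⟩ := h.tendsto_iterate hq0 hq1
  simp only [heineAt_eq]
  refine tendsto_tsum_of_dominated_convergence
    (summable_heine_majorant hq0 hq1 h.c_nonneg h.c_lt_one (norm_nonneg z) hz) (fun k => ?_)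
    (Filter.Eventually.of_forall fun n k => (h.iterate hq0 hq1 n).norm_term_le hq0 hq1
      (h.iterate_c_le hq0 hq1 n) h.c_lt_one z k)
  refine Filter.Tendsto.mul_const _ ((Complex.continuous_ofReal.tendsto _).comp ?_)
  have hQ := (realWatson_pos hq0 hq1 hq0.le hq1 k).ne'
  have := ((tendsto_realWatson hA q k).mul (tendsto_realWatson hB q k)).div
    ((tendsto_realWatson hC q k).mul_const (realWatson q q k)) (by simpa using hQ)
  rw [heineCoeff_zero]
  rw [one_mul, one_mul] at this
  exact this

/-- Heine's function has no zeros in the cut disk. -/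
theorem HeineAdmissible.heineAt_ne_zero {q : ℝ} (hq0 : 0 < q) (hq1 : q < 1) {p : ℝ × ℝ × ℝ}
    (h : HeineAdmissible q p) {z : ℂ} (hz : ‖z‖ < 1) (hzc : z ∈ cutPlane q) :
    heineAt q p z ≠ 0 := by
  intro h0
  have hzero : ∀ n, heineAt q ((heineShift q)^[n] p) z = 0 := by
    intro n
    induction n with
    | zero => exact h0
    | succ n ih =>
      obtain ⟨ν, -, -, hν⟩ := (h.iterate hq0 hq1 n).exists_measure hq0 hq1
      rw [Function.iterate_succ_apply', hν z hz hzc, ih, zero_mul]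
  have := h.tendsto_heineAt hq0 hq1 hz
  simp only [hzero] at this
  exact heineAt_zero_ne_zero hq0 hq1 hz (tendsto_nhds_unique this tendsto_const_nhds)

/-! ### Probability measures as Stieltjes measures. -/

/-- Every probability measure on `[0, 1]` is a Lebesgue–Stieltjes measure of a non-decreasing
function with values `0` and `1` at the end points. -/
theorem exists_stieltjesMeasure_eq (ν : Measure ℝ) [IsProbabilityMeasure ν]
    (hν : ∀ᵐ t ∂ν, t ∈ Set.Icc (0 : ℝ) 1) :
    ∃ μ : Set.Icc (0 : ℝ) 1 →o Set.Icc (0 : ℝ) 1, (μ 1 : ℝ) = 1 ∧ (μ 0 : ℝ) = 0 ∧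
      stieltjesMeasure μ = ν := by
  have hcdf1 : ∀ t : ℝ, 1 ≤ t → ProbabilityTheory.cdf ν t = 1 := by
    intro t ht
    rw [ProbabilityTheory.cdf_eq_real, Measure.real, ENNReal.toReal_eq_one_iff, prob_compl_eq_zero_iff₀
      (measurableSet_Iic.nullMeasurableSet) |>.symm]
    refine measure_mono_null ?_ (ae_iff.1 hν)
    intro x hx hx'
    exact hx (hx'.2.trans ht)
  have hcdf0 : ∀ t : ℝ, t < 0 → ProbabilityTheory.cdf ν t = 0 := by
    intro t ht
    rw [ProbabilityTheory.cdf_eq_real, Measure.real, ENNReal.toReal_eq_zero_iff]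
    left
    refine measure_mono_null ?_ (ae_iff.1 hν)
    intro x hx hx'
    exact absurd (hx'.1.trans hx) (not_le.2 ht)
  -- The distribution function is lowered to 0 at the point 0, so that an atom of ν there appears as
  -- the jump μ(0+) - μ(0).
  let μ : Set.Icc (0 : ℝ) 1 →o Set.Icc (0 : ℝ) 1 :=
    { toFun := fun t => if t = 0 then 0 else
        ⟨ProbabilityTheory.cdf ν t, ProbabilityTheory.cdf_nonneg ν _, ProbabilityTheory.cdf_le_one ν _⟩
      monotone' := by
        intro s t hst
        dsimp only
        split_ifs with h1 h2 h2
        · exact le_rfl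
        · exact bot_le
        · exact absurd (le_antisymm (hst.trans h2.le) bot_le) h1
        · exact ProbabilityTheory.monotone_cdf ν hst }
  have hμ0 : (μ 0 : ℝ) = 0 := by
    change ((if (0 : Set.Icc (0 : ℝ) 1) = 0 then (0 : Set.Icc (0 : ℝ) 1) else _ :
      Set.Icc (0 : ℝ) 1) : ℝ) = 0
    rw [if_pos rfl]; rfl
  have hμ : ∀ t : Set.Icc (0 : ℝ) 1, t ≠ 0 → (μ t : ℝ) = ProbabilityTheory.cdf ν t := by
    intro t ht
    change ((if t = 0 then (0 : Set.Icc (0 : ℝ) 1) else _ : Set.Icc (0 : ℝ) 1) : ℝ) = _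
    rw [if_neg ht]
  have hμ1 : (μ 1 : ℝ) = 1 := by rw [hμ 1 one_ne_zero]; exact hcdf1 1 le_rfl
  refine ⟨μ, hμ1, hμ0, ?_⟩
  have hext : ∀ t : ℝ, t ≠ 0 → Set.IccExtend (zero_le_one' ℝ) (fun t => (μ t : ℝ)) t =
      ProbabilityTheory.cdf ν t := by
    intro t ht
    rcases lt_or_ge t 0 with h | h
    · rw [Set.IccExtend_of_le_left _ _ h.le, hcdf0 t h]
      exact hμ0
    rcases le_total t 1 with h' | h'
    · rw [Set.IccExtend_of_mem _ _ ⟨h, h'⟩]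
      have : (⟨t, h, h'⟩ : Set.Icc (0 : ℝ) 1) ≠ 0 := by
        intro h2; exact ht (congrArg Subtype.val h2)
      exact hμ _ this
    · rw [Set.IccExtend_of_right_le _ _ h', hcdf1 t h']
      exact hμ1
  rw [stieltjesMeasure]
  conv_rhs => rw [← ProbabilityTheory.measure_cdf ν]
  congr 1
  ext t
  rw [Monotone.stieltjesFunction_eq]
  -- The Stieltjes measure depends only on right limits, which the changed value at 0 does not
  -- affect.
  have h1 : Filter.Tendsto (Set.IccExtend (zero_le_one' ℝ) (fun t => (μ t : ℝ)))
      (nhdsWithin t (Set.Ioi t)) (nhds (ProbabilityTheory.cdf ν t)) := by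
    have h2 := ((ProbabilityTheory.cdf ν).right_continuous t).mono Set.Ioi_subset_Ici_self
    refine Filter.Tendsto.congr' ?_ h2
    have : ∀ᶠ x in nhdsWithin t (Set.Ioi t), x ≠ 0 := by
      rcases eq_or_ne t 0 with rfl | ht
      · filter_upwards [self_mem_nhdsWithin] with x hx using ne_of_gt hx
      · exact nhdsWithin_le_nhds (isOpen_ne.mem_nhds ht)
    filter_upwards [this] with x hx using (hext x hx).symm
  exact rightLim_eq_of_tendsto h1

/-! ### Cauchy transforms: analyticity and injectivity. -/

/-- The Cauchy transform `z ↦ ∫ z / (1 - t z) dν(t)`. -/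
noncomputable def cauchyTransform (ν : Measure ℝ) (z : ℂ) : ℂ :=
  ∫ t : ℝ, z / (1 - (t : ℂ) * z) ∂ν

theorem integrable_of_continuousOn_Icc {E : Type*} [NormedAddCommGroup E] {ν : Measure ℝ}
    [IsFiniteMeasure ν] {R : ℝ} (hν : ∀ᵐ t ∂ν, t ∈ Set.Icc 0 R) {k : ℝ → E}
    (hk : ContinuousOn k (Set.Icc 0 R)) : Integrable k ν := by
  have := hk.integrableOn_compact (μ := ν) isCompact_Icc
  rwa [IntegrableOn, Measure.restrict_eq_self_of_ae_mem hν] at this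

theorem integral_pos_of_ae_pos {ν : Measure ℝ} [IsProbabilityMeasure ν] {k : ℝ → ℝ}
    (hk : Integrable k ν) (hpos : ∀ᵐ t ∂ν, 0 < k t) : 0 < ∫ t, k t ∂ν := by
  rw [integral_pos_iff_support_of_nonneg_ae (hpos.mono fun t ht => ht.le) hk]
  have : Function.support k =ᵐ[ν] Set.univ := by
    filter_upwards [hpos] with t ht
    exact propext ⟨fun _ => trivial, fun _ => ht.ne'⟩
  rw [measure_congr this]
  simp

/-- The set on which the kernel `1 / (1 - t z)` has no pole for `t ∈ [0, R]`. -/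
def slitDomain (R : ℝ) : Set ℂ := {z | ∀ t ∈ Set.Icc (0 : ℝ) R, 1 - (t : ℂ) * z ≠ 0}

theorem continuousOn_kernel {R : ℝ} {z : ℂ} (hz : z ∈ slitDomain R) (w : ℂ) :
    ContinuousOn (fun t : ℝ => w / (1 - (t : ℂ) * z)) (Set.Icc 0 R) :=
  continuousOn_const.div (by fun_prop) hz

theorem continuousOn_kernel_mul {R : ℝ} {z₁ z₂ : ℂ} (h₁ : z₁ ∈ slitDomain R)
    (h₂ : z₂ ∈ slitDomain R) :
    ContinuousOn (fun t : ℝ => 1 / ((1 - (t : ℂ) * z₁) * (1 - (t : ℂ) * z₂))) (Set.Icc 0 R) :=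
  continuousOn_const.div (by fun_prop) fun t ht => mul_ne_zero (h₁ t ht) (h₂ t ht)

/-- Compactness of [0, R] bounds the denominator away from 0 near z₀. This gives openness of the
domain and a dominating constant for differentiation under the integral. -/
theorem exists_ball_norm_ge {R : ℝ} (hR : 0 ≤ R) {z₀ : ℂ} (hz₀ : z₀ ∈ slitDomain R) :
    ∃ ε > 0, ∃ δ > 0, ∀ z ∈ Metric.ball z₀ ε, ∀ t ∈ Set.Icc (0 : ℝ) R,
      δ ≤ ‖1 - (t : ℂ) * z‖ := by
  obtain ⟨t₀, ht₀, hmin⟩ := isCompact_Icc.exists_isMinOn (Set.nonempty_Icc.2 hR)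
    (f := fun t : ℝ => ‖1 - (t : ℂ) * z₀‖) (by fun_prop)
  set d := ‖1 - (t₀ : ℂ) * z₀‖ with hd
  have hd0 : 0 < d := norm_pos_iff.2 (hz₀ t₀ ht₀)
  refine ⟨d / (2 * (R + 1)), by positivity, d / 2, by positivity, fun z hz t ht => ?_⟩
  have h1 : d ≤ ‖1 - (t : ℂ) * z₀‖ := hmin ht
  have h2 : ‖(t : ℂ) * (z - z₀)‖ ≤ d / 2 := by
    rw [norm_mul, Complex.norm_real, Real.norm_of_nonneg ht.1]
    rw [Metric.mem_ball, dist_eq_norm, lt_div_iff₀ (by positivity)] at hz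
    have := mul_le_mul_of_nonneg_right (ht.2.trans (by linarith : R ≤ R + 1)) (norm_nonneg (z - z₀))
    linarith
  have h3 : 1 - (t : ℂ) * z₀ = (1 - (t : ℂ) * z) + (t : ℂ) * (z - z₀) := by ring
  rw [h3] at h1
  linarith [norm_add_le (1 - (t : ℂ) * z) ((t : ℂ) * (z - z₀))]

theorem isOpen_slitDomain {R : ℝ} (hR : 0 ≤ R) : IsOpen (slitDomain R) := by
  rw [Metric.isOpen_iff]
  intro z₀ hz₀
  obtain ⟨ε, hε, δ, hδ, h⟩ := exists_ball_norm_ge hR hz₀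
  exact ⟨ε, hε, fun z hz t ht => norm_pos_iff.1 (hδ.trans_le (h z hz t ht))⟩

theorem differentiableAt_cauchyTransform {ν : Measure ℝ} [IsFiniteMeasure ν] {R : ℝ} (hR : 0 ≤ R)
    (hν : ∀ᵐ t ∂ν, t ∈ Set.Icc 0 R) {z₀ : ℂ} (hz₀ : z₀ ∈ slitDomain R) :
    DifferentiableAt ℂ (cauchyTransform ν) z₀ := by
  obtain ⟨ε, hε, δ, hδ, h⟩ := exists_ball_norm_ge hR hz₀
  have hslit : ∀ z ∈ Metric.ball z₀ ε, z ∈ slitDomain R := fun z hz t ht =>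
    norm_pos_iff.1 (hδ.trans_le (h z hz t ht))
  have key := hasDerivAt_integral_of_dominated_loc_of_deriv_le (μ := ν)
    (F := fun (z : ℂ) (t : ℝ) => z / (1 - (t : ℂ) * z))
    (F' := fun (z : ℂ) (t : ℝ) => 1 / ((1 - (t : ℂ) * z) * (1 - (t : ℂ) * z)))
    (bound := fun _ => 1 / (δ * δ)) (Metric.ball_mem_nhds z₀ hε) ?_ ?_ ?_ ?_ ?_ ?_
  · exact key.2.differentiableAt
  · filter_upwards [Metric.ball_mem_nhds z₀ hε] with z hz
    exact (integrable_of_continuousOn_Icc hν (continuousOn_kernel (hslit z hz) z)).1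
  · exact integrable_of_continuousOn_Icc hν (continuousOn_kernel hz₀ z₀)
  · exact (integrable_of_continuousOn_Icc hν (continuousOn_kernel_mul hz₀ hz₀)).1
  · filter_upwards [hν] with t ht z hz
    have := h z hz t ht
    rw [norm_div, norm_one, norm_mul]
    gcongr
  · exact integrable_const _
  · filter_upwards [hν] with t ht z hz
    have h0 : 1 - (t : ℂ) * z ≠ 0 := hslit z hz t ht
    have h1 := (hasDerivAt_id z).div (((hasDerivAt_id z).const_mul (t : ℂ)).const_sub 1) h0
    refine HasDerivAt.congr_deriv h1 ?_
    rw [sq]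
    congr 1
    simp only [id]
    ring

theorem analyticOnNhd_cauchyTransform {ν : Measure ℝ} [IsFiniteMeasure ν] {R : ℝ} (hR : 0 ≤ R)
    (hν : ∀ᵐ t ∂ν, t ∈ Set.Icc 0 R) : AnalyticOnNhd ℂ (cauchyTransform ν) (slitDomain R) :=
  DifferentiableOn.analyticOnNhd
    (fun _ hz => (differentiableAt_cauchyTransform hR hν hz).differentiableWithinAt)
    (isOpen_slitDomain hR)

/-- The half-plane to the left of `1 / R`. -/
def leftHalfPlane (R : ℝ) : Set ℂ := {z | R * z.re < 1}

theorem one_sub_mul_re_pos {R : ℝ} {z : ℂ} (hz : z ∈ leftHalfPlane R) {t : ℝ}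
    (ht : t ∈ Set.Icc 0 R) : 0 < 1 - t * z.re := by
  have h1 : R * z.re < 1 := hz
  rcases le_total z.re 0 with h | h
  · nlinarith [ht.1]
  · nlinarith [ht.2]

theorem leftHalfPlane_subset_slitDomain (R : ℝ) : leftHalfPlane R ⊆ slitDomain R := by
  intro z hz t ht h
  have := congrArg Complex.re h
  simp at this
  linarith [one_sub_mul_re_pos hz ht]

theorem cauchyTransform_sub {ν : Measure ℝ} [IsFiniteMeasure ν] {R : ℝ}
    (hν : ∀ᵐ t ∂ν, t ∈ Set.Icc 0 R) {z₁ z₂ : ℂ} (h₁ : z₁ ∈ slitDomain R) (h₂ : z₂ ∈ slitDomain R) :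
    cauchyTransform ν z₁ - cauchyTransform ν z₂ =
      (z₁ - z₂) * ∫ t : ℝ, 1 / ((1 - (t : ℂ) * z₁) * (1 - (t : ℂ) * z₂)) ∂ν := by
  rw [cauchyTransform, cauchyTransform, ← integral_sub
    (integrable_of_continuousOn_Icc hν (continuousOn_kernel h₁ z₁))
    (integrable_of_continuousOn_Icc hν (continuousOn_kernel h₂ z₂)), ← integral_const_mul]
  refine integral_congr_ae ?_
  filter_upwards [hν] with t ht
  rw [div_sub_div _ _ (h₁ t ht) (h₂ t ht), mul_one_div]
  congr 1
  ring

theorem integral_re_eq {ν : Measure ℝ} {k : ℝ → ℂ} (hk : Integrable k ν) :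
    (∫ t, k t ∂ν).re = ∫ t, (k t).re ∂ν := (integral_re (𝕜 := ℂ) hk).symm

theorem integral_im_eq {ν : Measure ℝ} {k : ℝ → ℂ} (hk : Integrable k ν) :
    (∫ t, k t ∂ν).im = ∫ t, (k t).im ∂ν := (integral_im (𝕜 := ℂ) hk).symm

/-- Im (z/(1 - tz)) = Im z / |1 - tz|², so the transform preserves the sign of the imaginary part.
-/
theorem cauchyTransform_im {ν : Measure ℝ} [IsProbabilityMeasure ν] {R : ℝ}
    (hν : ∀ᵐ t ∂ν, t ∈ Set.Icc 0 R) {z : ℂ} (hz : z ∈ slitDomain R) :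
    ∃ m : ℝ, 0 < m ∧ (cauchyTransform ν z).im = z.im * m := by
  have hk := integrable_of_continuousOn_Icc hν (continuousOn_kernel hz z)
  have hc : ContinuousOn (fun t : ℝ => 1 / Complex.normSq (1 - (t : ℂ) * z)) (Set.Icc 0 R) :=
    continuousOn_const.div (Complex.continuous_normSq.comp_continuousOn (by fun_prop))
      fun t ht => (Complex.normSq_pos.2 (hz t ht)).ne'
  refine ⟨∫ t : ℝ, 1 / Complex.normSq (1 - (t : ℂ) * z) ∂ν,
    integral_pos_of_ae_pos (integrable_of_continuousOn_Icc hν hc) ?_, ?_⟩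
  · filter_upwards [hν] with t ht
    exact one_div_pos.2 (Complex.normSq_pos.2 (hz t ht))
  · rw [cauchyTransform, integral_im_eq hk, ← integral_const_mul]
    refine integral_congr_ae ?_
    filter_upwards [hν] with t ht
    have := (Complex.normSq_pos.2 (hz t ht)).ne'
    rw [Complex.div_im]
    simp
    field_simp
    ring

/-- Non-vanishing of the divided difference for two points of one closed half-plane
`σ * Im z ≥ 0`. -/
theorem integral_kernel_mul_ne_zero {ν : Measure ℝ} [IsProbabilityMeasure ν] {R : ℝ}
    (hν : ∀ᵐ t ∂ν, t ∈ Set.Icc 0 R) {z₁ z₂ : ℂ} (h₁ : z₁ ∈ leftHalfPlane R)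
    (h₂ : z₂ ∈ leftHalfPlane R) {σ : ℝ} (hσ : σ ≠ 0) (hs₁ : 0 ≤ σ * z₁.im) (hs₂ : 0 ≤ σ * z₂.im) :
    ∫ t : ℝ, 1 / ((1 - (t : ℂ) * z₁) * (1 - (t : ℂ) * z₂)) ∂ν ≠ 0 := by
  intro h0
  have g₁ := leftHalfPlane_subset_slitDomain R h₁
  have g₂ := leftHalfPlane_subset_slitDomain R h₂
  have hk := integrable_of_continuousOn_Icc hν (continuousOn_kernel_mul g₁ g₂)
  have hre := integral_re_eq hk
  have him := integral_im_eq hk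
  rw [h0] at hre him
  simp only [Complex.zero_re, Complex.zero_im] at hre him
  have hRe : ∀ t : ℝ, (1 / ((1 - (t : ℂ) * z₁) * (1 - (t : ℂ) * z₂))).re =
      ((1 - t * z₁.re) * (1 - t * z₂.re) - t * z₁.im * (t * z₂.im)) /
        Complex.normSq ((1 - (t : ℂ) * z₁) * (1 - (t : ℂ) * z₂)) := by
    intro t
    rw [one_div, Complex.inv_re]
    simp
  have hIm : ∀ t : ℝ, (1 / ((1 - (t : ℂ) * z₁) * (1 - (t : ℂ) * z₂))).im =
      ((1 - t * z₁.re) * (t * z₂.im) + (1 - t * z₂.re) * (t * z₁.im)) /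
        Complex.normSq ((1 - (t : ℂ) * z₁) * (1 - (t : ℂ) * z₂)) := by
    intro t
    rw [one_div, Complex.inv_im]
    congr 1
    simp
    ring
  -- With both points on one side of the real axis, the imaginary part of the kernel has constant
  -- sign. A vanishing integral makes it zero almost everywhere, hence t Im z₁ = 0, and then the
  -- real part is positive.
  have hnonneg : 0 ≤ᵐ[ν] fun t : ℝ => σ * (1 / ((1 - (t : ℂ) * z₁) * (1 - (t : ℂ) * z₂))).im := by
    filter_upwards [hν] with t ht
    have a1 := one_sub_mul_re_pos h₁ ht
    have a2 := one_sub_mul_re_pos h₂ ht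
    have a3 := mul_nonneg ht.1 hs₁
    have a4 := mul_nonneg ht.1 hs₂
    simp only [Pi.zero_apply, hIm]
    rw [← mul_div_assoc]
    refine div_nonneg ?_ (Complex.normSq_nonneg _)
    nlinarith [mul_nonneg a1.le a4, mul_nonneg a2.le a3]
  have hzero := (integral_eq_zero_iff_of_nonneg_ae hnonneg (hk.im.const_mul σ)).1 (by
    rw [integral_const_mul, ← him, mul_zero])
  refine hre.not_lt (integral_pos_of_ae_pos hk.re ?_)
  filter_upwards [hν, hzero] with t ht hz
  have a1 := one_sub_mul_re_pos h₁ ht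
  have a2 := one_sub_mul_re_pos h₂ ht
  have a3 := mul_nonneg ht.1 hs₁
  have a4 := mul_nonneg ht.1 hs₂
  have hn : 0 < Complex.normSq ((1 - (t : ℂ) * z₁) * (1 - (t : ℂ) * z₂)) :=
    Complex.normSq_pos.2 (mul_ne_zero (g₁ t ht) (g₂ t ht))
  simp only [Pi.zero_apply, hIm, mul_eq_zero, hσ, false_or, div_eq_zero_iff, hn.ne', or_false] at hz
  have b1 : t * z₁.im = 0 := by
    have c1 : (1 - t * z₁.re) * (t * (σ * z₂.im)) + (1 - t * z₂.re) * (t * (σ * z₁.im)) = 0 := by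
      linear_combination σ * hz
    have c2 : (1 - t * z₂.re) * (t * (σ * z₁.im)) = 0 := by
      linarith [mul_nonneg a1.le a4, mul_nonneg a2.le a3]
    have c3 := (mul_eq_zero.1 c2).resolve_left a2.ne'
    have c4 : σ * (t * z₁.im) = 0 := by linear_combination c3
    exact (mul_eq_zero.1 c4).resolve_left hσ
  change 0 < (1 / ((1 - (t : ℂ) * z₁) * (1 - (t : ℂ) * z₂))).re
  rw [hRe, b1, zero_mul, sub_zero]
  positivity

theorem injOn_cauchyTransform {ν : Measure ℝ} [IsProbabilityMeasure ν] {R : ℝ}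
    (hν : ∀ᵐ t ∂ν, t ∈ Set.Icc 0 R) : Set.InjOn (cauchyTransform ν) (leftHalfPlane R) := by
  intro z₁ h₁ z₂ h₂ heq
  have g₁ := leftHalfPlane_subset_slitDomain R h₁
  have g₂ := leftHalfPlane_subset_slitDomain R h₂
  obtain ⟨m₁, hm₁, e₁⟩ := cauchyTransform_im hν g₁
  obtain ⟨m₂, hm₂, e₂⟩ := cauchyTransform_im hν g₂
  have him : z₁.im * m₁ = z₂.im * m₂ := by rw [← e₁, ← e₂, heq]
  -- Equal values have equal imaginary parts, so z₁ and z₂ lie in a common closed half-plane.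
  obtain ⟨σ, hσ, hs₁, hs₂⟩ : ∃ σ : ℝ, σ ≠ 0 ∧ 0 ≤ σ * z₁.im ∧ 0 ≤ σ * z₂.im := by
    rcases le_total 0 z₁.im with h | h
    · refine ⟨1, one_ne_zero, by linarith, ?_⟩
      rw [one_mul]
      exact nonneg_of_mul_nonneg_left (him ▸ mul_nonneg h hm₁.le) hm₂
    · refine ⟨-1, by norm_num, by linarith, ?_⟩
      have := nonpos_of_mul_nonpos_left (him ▸ mul_nonpos_of_nonpos_of_nonneg h hm₁.le) hm₂
      linarith
  have := cauchyTransform_sub hν g₁ g₂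
  rw [heq, sub_self] at this
  exact sub_eq_zero.1 ((mul_eq_zero.1 this.symm).resolve_right
    (integral_kernel_mul_ne_zero hν h₁ h₂ hσ hs₁ hs₂))

/-! ### Convexity in the direction of the imaginary axis. -/

/-- On circles centred on the real axis the real part of the Cauchy transform is a strictly
increasing function of the real part. -/
theorem cauchyTransform_re_lt {ν : Measure ℝ} [IsProbabilityMeasure ν] {R : ℝ}
    (hν : ∀ᵐ t ∂ν, t ∈ Set.Icc 0 R) {c ρ : ℝ} (hρ : 0 < ρ) (hcρ : R * (c + ρ) < 1) {z₁ z₂ : ℂ}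
    (h₁ : z₁ ∈ leftHalfPlane R) (h₂ : z₂ ∈ leftHalfPlane R)
    (e₁ : Complex.normSq (z₁ - c) = ρ ^ 2) (e₂ : Complex.normSq (z₂ - c) = ρ ^ 2)
    (hlt : z₁.re < z₂.re) :
    (cauchyTransform ν z₁).re < (cauchyTransform ν z₂).re := by
  have g₁ := leftHalfPlane_subset_slitDomain R h₁
  have g₂ := leftHalfPlane_subset_slitDomain R h₂
  have k₁ := integrable_of_continuousOn_Icc hν (continuousOn_kernel g₁ z₁)
  have k₂ := integrable_of_continuousOn_Icc hν (continuousOn_kernel g₂ z₂)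
  have r₁ : Integrable (fun t : ℝ => (z₁ / (1 - (t : ℂ) * z₁)).re) ν := k₁.re
  have r₂ : Integrable (fun t : ℝ => (z₂ / (1 - (t : ℂ) * z₂)).re) ν := k₂.re
  rw [cauchyTransform, cauchyTransform, integral_re_eq k₁, integral_re_eq k₂, ← sub_pos,
    ← integral_sub r₂ r₁]
  refine integral_pos_of_ae_pos (r₂.sub r₁) ?_
  filter_upwards [hν] with t ht
  rw [sub_pos]
  have hre : ∀ z : ℂ, (z / (1 - (t : ℂ) * z)).re =
      (z.re - t * (z.re ^ 2 + z.im ^ 2)) / Complex.normSq (1 - (t : ℂ) * z) := by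
    intro z
    rw [Complex.div_re, ← add_div]
    congr 1
    simp
    ring
  have hn : ∀ z : ℂ, Complex.normSq (1 - (t : ℂ) * z) =
      1 - 2 * t * z.re + t ^ 2 * (z.re ^ 2 + z.im ^ 2) := by
    intro z
    rw [Complex.normSq_apply]
    simp
    ring
  have p₁ := Complex.normSq_pos.2 (g₁ t ht)
  have p₂ := Complex.normSq_pos.2 (g₂ t ht)
  rw [Complex.normSq_apply] at e₁ e₂
  simp only [Complex.sub_re, Complex.ofReal_re, Complex.sub_im, Complex.ofReal_im, sub_zero]
    at e₁ e₂
  -- On the circle |z|² is affine in Re z, so the real part of the kernel is a Möbius function of Re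
  -- z. The sign of its determinant is that of (1 - tc)² - t²ρ².
  have q₁ : z₁.re ^ 2 + z₁.im ^ 2 = ρ ^ 2 - c ^ 2 + 2 * c * z₁.re := by linear_combination e₁
  have q₂ : z₂.re ^ 2 + z₂.im ^ 2 = ρ ^ 2 - c ^ 2 + 2 * c * z₂.re := by linear_combination e₂
  rw [hre, hre, div_lt_div_iff₀ p₁ p₂, hn, hn, q₁, q₂, ← sub_pos]
  have hpos : 0 < 1 - t * c - t * ρ := by
    rcases le_total (c + ρ) 0 with h | h
    · nlinarith [ht.1]
    · nlinarith [ht.2]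
  have hpos' : 0 < 1 - t * c + t * ρ := by nlinarith [ht.1]
  calc 0 < (z₂.re - z₁.re) * ((1 - t * c - t * ρ) * (1 - t * c + t * ρ)) :=
        mul_pos (sub_pos.2 hlt) (mul_pos hpos hpos')
    _ = _ := by ring

/-- A bounded open subset of the line with at most two boundary points is an interval. -/
theorem ordConnected_of_frontier {S : Set ℝ} (hS : IsOpen S) (hb : Bornology.IsBounded S)
    {Y₁ Y₂ : ℝ} (hf : ∀ y ∈ closure S, y ∉ S → y = Y₁ ∨ y = Y₂) : S.OrdConnected := by
  -- Leaving S forces a boundary point. A gap at y, together with the two outer ends of the bounded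
  -- set S, yields three distinct boundary points p₀ < p₁ < p₂.
  have hex : ∀ u ∈ S, ∀ v ∉ S, ∃ p ∈ Set.uIcc u v, p ∈ closure S ∧ p ∉ S := by
    intro u hu v hv
    by_contra! hcon
    exact hv (isPreconnected_uIcc.subset_of_closure_inter_subset hS ⟨u, Set.left_mem_uIcc, hu⟩
      (fun p hp => hcon p hp.2 hp.1) Set.right_mem_uIcc)
  refine ⟨fun y₁ h₁ y₂ h₂ y hy => ?_⟩
  by_contra hyS
  obtain ⟨M, hM⟩ := hb.subset_closedBall 0
  have hbd : ∀ s ∈ S, -M ≤ s ∧ s ≤ M := by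
    intro s hs
    have := hM hs
    rwa [Metric.mem_closedBall, dist_zero_right, Real.norm_eq_abs, abs_le] at this
  obtain ⟨p₀, i₀, c₀, n₀⟩ := hex y₁ h₁ (-M - 1) (fun h => by linarith [(hbd _ h).1])
  obtain ⟨p₁, i₁, c₁, n₁⟩ := hex y₁ h₁ y hyS
  obtain ⟨p₂, i₂, c₂, n₂⟩ := hex y₂ h₂ (M + 1) (fun h => by linarith [(hbd _ h).2])
  rw [Set.uIcc_of_ge (by linarith [(hbd _ h₁).1])] at i₀
  rw [Set.uIcc_of_le hy.1] at i₁
  rw [Set.uIcc_of_le (by linarith [(hbd _ h₂).2])] at i₂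
  have l₀ : p₀ < y₁ := lt_of_le_of_ne i₀.2 fun h => n₀ (h ▸ h₁)
  have l₁ : y₁ < p₁ := lt_of_le_of_ne i₁.1 fun h => n₁ (h ▸ h₁)
  have l₂ : y₂ < p₂ := lt_of_le_of_ne i₂.1 fun h => n₂ (h ▸ h₂)
  have l₃ : p₁ < p₂ := (i₁.2.trans hy.2).trans_lt l₂
  have l₄ : p₀ < p₁ := l₀.trans l₁
  rcases hf p₀ c₀ n₀ with a | a <;> rcases hf p₁ c₁ n₁ with b | b <;>
    rcases hf p₂ c₂ n₂ with d | d <;> linarith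

theorem isOpen_image_cauchyTransform {ν : Measure ℝ} [IsProbabilityMeasure ν] {R : ℝ}
    (hR : 0 < R) (hν : ∀ᵐ t ∂ν, t ∈ Set.Icc 0 R) {U : Set ℂ} (hU : IsOpen U)
    (hUR : U ⊆ leftHalfPlane R) : IsOpen (cauchyTransform ν '' U) := by
  have hconv : Convex ℝ (leftHalfPlane R) := by
    have : leftHalfPlane R = {z : ℂ | z.re < 1 / R} := by
      ext z
      simp only [leftHalfPlane, Set.mem_ofPred_eq]
      rw [lt_div_iff₀ hR, mul_comm]
    rw [this]
    exact convex_halfSpace_re_lt _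
  rcases ((analyticOnNhd_cauchyTransform hR.le hν).mono
    (leftHalfPlane_subset_slitDomain R)).is_constant_or_isOpen hconv.isPreconnected with h | h
  · obtain ⟨w, hw⟩ := h
    have h0 : (0 : ℂ) ∈ leftHalfPlane R := by simp [leftHalfPlane]
    have h1 : (-1 : ℂ) ∈ leftHalfPlane R := by
      simp [leftHalfPlane]; linarith
    have := injOn_cauchyTransform hν h0 h1 ((hw _ h0).trans (hw _ h1).symm)
    norm_num at this
  · exact h U hUR hU

theorem closedBall_subset_leftHalfPlane {R c ρ : ℝ} (hR : 0 < R) (hcρ : R * (c + ρ) < 1) :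
    Metric.closedBall (c : ℂ) ρ ⊆ leftHalfPlane R := by
  intro z hz
  rw [Metric.mem_closedBall, dist_eq_norm] at hz
  have := (Complex.re_le_norm (z - c)).trans hz
  simp at this
  change R * z.re < 1
  nlinarith

/-- Boundary points of the slice come from the bounding circle. There Re f determines Re z, so z is
one of two conjugate points; the slice is open and bounded with at most two boundary points. -/
theorem convex_slice_cauchyTransform_ball {ν : Measure ℝ} [IsProbabilityMeasure ν] {R : ℝ}
    (hR : 0 < R) (hν : ∀ᵐ t ∂ν, t ∈ Set.Icc 0 R) {c ρ : ℝ} (hρ : 0 < ρ)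
    (hcρ : R * (c + ρ) < 1) (x : ℝ) :
    Convex ℝ (cauchyTransform ν '' Metric.ball (c : ℂ) ρ ∩ {w : ℂ | w.re = x}) := by
  set f := cauchyTransform ν
  have hsub := closedBall_subset_leftHalfPlane hR hcρ
  have hopen : IsOpen (f '' Metric.ball (c : ℂ) ρ) :=
    isOpen_image_cauchyTransform hR hν Metric.isOpen_ball (Metric.ball_subset_closedBall.trans hsub)
  have hcomp : IsCompact (f '' Metric.closedBall (c : ℂ) ρ) :=
    (isCompact_closedBall _ _).image_of_continuousOn
      (((analyticOnNhd_cauchyTransform hR.le hν).mono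
        (hsub.trans (leftHalfPlane_subset_slitDomain R))).continuousOn)
  let L : ℝ → ℂ := fun y => ⟨x, y⟩
  have hL : Continuous L := by
    have : L = fun y : ℝ => (x : ℂ) + y * Complex.I := by
      ext y; exact Complex.mk_eq_add_mul_I x y
    rw [this]; fun_prop
  set S : Set ℝ := L ⁻¹' (f '' Metric.ball (c : ℂ) ρ) with hSdef
  have hSb : Bornology.IsBounded S := by
    obtain ⟨M, hM⟩ := hcomp.isBounded.subset_closedBall 0
    refine (Metric.isBounded_closedBall (x := (0 : ℝ)) (r := M)).subset fun y hy => ?_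
    have h1 := hM (Set.image_mono Metric.ball_subset_closedBall hy)
    rw [Metric.mem_closedBall, dist_zero_right] at h1 ⊢
    exact (Complex.abs_im_le_norm (L y)).trans h1
  have hbdry : ∀ y ∈ closure S, y ∉ S → ∃ z : ℂ, z ∈ leftHalfPlane R ∧
      Complex.normSq (z - c) = ρ ^ 2 ∧ f z = L y := by
    intro y hy hyS
    have h1 : L y ∈ f '' Metric.closedBall (c : ℂ) ρ := by
      have h2 := hL.closure_preimage_subset _ hy
      exact closure_minimal (Set.image_mono Metric.ball_subset_closedBall) hcomp.isClosed h2
    obtain ⟨z, hz, hzy⟩ := h1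
    refine ⟨z, hsub hz, ?_, hzy⟩
    rw [Complex.normSq_eq_norm_sq, ← dist_eq_norm]
    rcases lt_or_eq_of_le (Metric.mem_closedBall.1 hz) with h | h
    · exact absurd ⟨z, h, hzy⟩ hyS
    · rw [h]
  have huniq : ∀ z₁ z₂ : ℂ, z₁ ∈ leftHalfPlane R → z₂ ∈ leftHalfPlane R →
      Complex.normSq (z₁ - c) = ρ ^ 2 → Complex.normSq (z₂ - c) = ρ ^ 2 →
      (f z₁).re = (f z₂).re → z₁ = z₂ ∨ z₁ = (starRingEnd ℂ) z₂ := by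
    intro z₁ z₂ h₁ h₂ e₁ e₂ he
    have hre : z₁.re = z₂.re := by
      rcases lt_trichotomy z₁.re z₂.re with h | h | h
      · exact absurd he (cauchyTransform_re_lt hν hρ hcρ h₁ h₂ e₁ e₂ h).ne
      · exact h
      · exact absurd he (cauchyTransform_re_lt hν hρ hcρ h₂ h₁ e₂ e₁ h).ne'
    have him : z₁.im ^ 2 = z₂.im ^ 2 := by
      rw [Complex.normSq_apply] at e₁ e₂
      simp [hre] at e₁ e₂
      linear_combination e₁ - e₂
    rcases sq_eq_sq_iff_eq_or_eq_neg.1 him with h | h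
    · exact Or.inl (Complex.ext hre h)
    · exact Or.inr (Complex.ext (by simpa using hre) (by simpa using h))
  have hord : S.OrdConnected := by
    by_cases hex : ∃ y ∈ closure S, y ∉ S
    · obtain ⟨y₀, hy₀, hyS₀⟩ := hex
      obtain ⟨z₀, a₀, b₀, d₀⟩ := hbdry y₀ hy₀ hyS₀
      refine ordConnected_of_frontier (hopen.preimage hL) hSb (Y₁ := y₀)
        (Y₂ := (f ((starRingEnd ℂ) z₀)).im) fun y hy hyS => ?_
      obtain ⟨z, a, b, d⟩ := hbdry y hy hyS
      rcases huniq z z₀ a a₀ b b₀ (by rw [d, d₀]) with h | h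
      · left
        have : L y = L y₀ := by rw [← d, ← d₀, h]
        exact congrArg Complex.im this
      · right
        rw [← h, d]
    · push Not at hex
      exact ordConnected_of_frontier (hopen.preimage hL) hSb (Y₁ := 0) (Y₂ := 0)
        fun y hy hyS => absurd (hex y hy) hyS
  have hconv : Convex ℝ S := hord.convex
  have hLw : ∀ w : ℂ, w.re = x → L w.im = w := fun w hw => Complex.ext hw.symm rfl
  intro w₁ h₁ w₂ h₂ a b ha hb hab
  have e : (a • w₁ + b • w₂).re = x := by
    have i₁ : w₁.re = x := h₁.2
    have i₂ : w₂.re = x := h₂.2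
    simp [i₁, i₂]
    rw [← add_mul, hab, one_mul]
  refine ⟨?_, e⟩
  have m := hconv (x := w₁.im) (by simpa [S, hLw w₁ h₁.2] using h₁.1) (y := w₂.im)
    (by simpa [S, hLw w₂ h₂.2] using h₂.1) ha hb hab
  have m' : L (a • w₁.im + b • w₂.im) ∈ f '' Metric.ball (c : ℂ) ρ := m
  rwa [show a • w₁.im + b • w₂.im = (a • w₁ + b • w₂).im by simp, hLw _ e] at m'

/-- The mapping property on convex domains in which any two points lie in a disk centred on the
real axis. -/
theorem mapsUnivalently_cauchyTransform {ν : Measure ℝ} [IsProbabilityMeasure ν] {R : ℝ}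
    (hR : 0 < R) (hν : ∀ᵐ t ∂ν, t ∈ Set.Icc 0 R) {U : Set ℂ} (hU : IsOpen U) (hUc : Convex ℝ U)
    (hU0 : U.Nonempty) (hUR : U ⊆ leftHalfPlane R)
    (hball : ∀ z₁ ∈ U, ∀ z₂ ∈ U, ∃ c ρ : ℝ, 0 < ρ ∧ R * (c + ρ) < 1 ∧
      Metric.ball (c : ℂ) ρ ⊆ U ∧ z₁ ∈ Metric.ball (c : ℂ) ρ ∧ z₂ ∈ Metric.ball (c : ℂ) ρ) :
    MapsUnivalentlyOntoConvexInImagDirection (cauchyTransform ν) U := by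
  have han := (analyticOnNhd_cauchyTransform hR.le hν).mono
    (hUR.trans (leftHalfPlane_subset_slitDomain R))
  refine ⟨han, (injOn_cauchyTransform hν).mono hUR, isOpen_image_cauchyTransform hR hν hU hUR,
    ⟨hU0.image _, hUc.isPreconnected.image _ han.continuousOn⟩, fun x => ?_⟩
  rintro _ ⟨⟨z₁, hz₁, rfl⟩, h₁⟩ _ ⟨⟨z₂, hz₂, rfl⟩, h₂⟩ a b ha hb hab
  obtain ⟨c, ρ, hρ, hcρ, hs, m₁, m₂⟩ := hball z₁ hz₁ z₂ hz₂
  have := convex_slice_cauchyTransform_ball hR hν hρ hcρ x ⟨⟨z₁, m₁, rfl⟩, h₁⟩ ⟨⟨z₂, m₂, rfl⟩, h₂⟩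
    ha hb hab
  exact ⟨Set.image_mono hs this.1, this.2⟩

theorem mapsUnivalently_cauchyTransform_ball {ν : Measure ℝ} [IsProbabilityMeasure ν] {r : ℝ}
    (hr : 0 < r) (hν : ∀ᵐ t ∂ν, t ∈ Set.Icc 0 (1 / r)) :
    MapsUnivalentlyOntoConvexInImagDirection (cauchyTransform ν) {z : ℂ | ‖z‖ < r} := by
  have hset : {z : ℂ | ‖z‖ < r} = Metric.ball 0 r := by ext z; simp
  rw [hset]
  refine mapsUnivalently_cauchyTransform (one_div_pos.2 hr) hν Metric.isOpen_ball (convex_ball _ _)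
    ⟨0, Metric.mem_ball_self hr⟩ ?_ ?_
  · intro z hz
    have h1 : z.re < r := (Complex.re_le_norm z).trans_lt (by simpa using hz)
    change 1 / r * z.re < 1
    rwa [one_div, inv_mul_lt_iff₀ hr, mul_one]
  · intro z₁ h₁ z₂ h₂
    rw [mem_ball_zero_iff] at h₁ h₂
    -- A strictly smaller radius keeps the closed disk inside the half-plane of analyticity.
    obtain ⟨ρ, hρ, hρr⟩ := exists_between (max_lt h₁ h₂)
    have hρ0 : 0 < ρ := ((norm_nonneg z₁).trans (le_max_left _ _)).trans_lt hρ
    refine ⟨0, ρ, hρ0, ?_, ?_, ?_, ?_⟩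
    · rw [zero_add, one_div, inv_mul_lt_iff₀ hr, mul_one]; exact hρr
    · rw [Complex.ofReal_zero]; exact Metric.ball_subset_ball hρr.le
    · simpa using (le_max_left _ _).trans_lt hρ
    · simpa using (le_max_right _ _).trans_lt hρ

theorem mapsUnivalently_cauchyTransform_halfPlane {ν : Measure ℝ} [IsProbabilityMeasure ν] {r : ℝ}
    (hr : 0 < r) (hν : ∀ᵐ t ∂ν, t ∈ Set.Icc 0 (1 / r)) :
    MapsUnivalentlyOntoConvexInImagDirection (cauchyTransform ν) {z : ℂ | z.re < r} := by
  have hhalf : ∀ s : ℝ, 1 / r * s < 1 ↔ s < r := fun s => by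
    rw [one_div, inv_mul_lt_iff₀ hr, mul_one]
  refine mapsUnivalently_cauchyTransform (one_div_pos.2 hr) hν
    (isOpen_lt Complex.continuous_re continuous_const) (convex_halfSpace_re_lt r)
    ⟨0, by simpa using hr⟩ (fun z hz => (hhalf _).2 hz) ?_
  intro z₁ h₁ z₂ h₂
  have i₁ : z₁.re < r := h₁
  have i₂ : z₂.re < r := h₂
  obtain ⟨e, he, her⟩ := exists_between (max_lt i₁ i₂)
  have a₁ := (le_max_left z₁.re z₂.re).trans_lt he
  have a₂ := (le_max_right z₁.re z₂.re).trans_lt he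
  -- For Re z < e, the inequality |z - (e - ρ)| < ρ is equivalent to B z < ρ. Disks touching the
  -- line Re z = e from the left thus exhaust the half-plane Re z < e as ρ grows.
  set B : ℂ → ℝ := fun z => Complex.normSq (z - e) / (2 * (e - z.re))
  have hmem : ∀ (z : ℂ) (ρ : ℝ), 0 < ρ → z.re < e → B z < ρ →
      z ∈ Metric.ball ((e - ρ : ℝ) : ℂ) ρ := by
    intro z ρ hρ hz hB
    rw [div_lt_iff₀ (by linarith), Complex.normSq_apply] at hB
    simp at hB
    rw [Metric.mem_ball, dist_eq_norm]
    refine lt_of_pow_lt_pow_left₀ 2 hρ.le ?_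
    rw [← Complex.normSq_eq_norm_sq, Complex.normSq_apply]
    simp
    nlinarith
  obtain ⟨ρ, hρ⟩ := exists_gt (max 0 (max (B z₁) (B z₂)))
  have b₀ := (le_max_left _ _).trans_lt hρ
  have b₁ := ((le_max_left _ _).trans (le_max_right _ _)).trans_lt hρ
  have b₂ := ((le_max_right _ _).trans (le_max_right _ _)).trans_lt hρ
  refine ⟨e - ρ, ρ, b₀, (hhalf _).2 (by linarith), ?_, hmem _ _ b₀ a₁ b₁, hmem _ _ b₀ a₂ b₂⟩
  intro z hz
  exact (hhalf _).1 (closedBall_subset_leftHalfPlane (one_div_pos.2 hr)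
    ((hhalf (e - ρ + ρ)).2 (by linarith)) (Metric.ball_subset_closedBall hz))

/-! ### Support of the measure when the quotient is analytic in the unit disk. -/

theorem HeineAdmissible.differentiableAt {q : ℝ} (hq0 : 0 < q) (hq1 : q < 1) {p : ℝ × ℝ × ℝ}
    (h : HeineAdmissible q p) {z : ℂ} (hz : ‖z‖ < 1) : DifferentiableAt ℂ (heineAt q p) z := by
  obtain ⟨r, hr, hr1⟩ := exists_between hz
  have hr0 : 0 ≤ r := (norm_nonneg z).trans hr.le
  have hd : DifferentiableOn ℂ (fun w : ℂ => ∑' n : ℕ, (heineCoeff p.1 p.2.1 p.2.2 q n : ℂ) * w ^ n)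
      (Metric.ball 0 r) := by
    refine Complex.differentiableOn_tsum_of_summable_norm
      (summable_heine_majorant hq0 hq1 h.c_nonneg h.c_lt_one hr0 hr1) (fun n => by fun_prop)
      Metric.isOpen_ball fun n w hw => ?_
    have := h.norm_term_le_of_le hq0 hq1 (z := (r : ℂ)) (w := w) (by
      rw [Complex.norm_real, Real.norm_of_nonneg hr0]
      exact (mem_ball_zero_iff.1 hw).le) n
    rwa [Complex.norm_real, Real.norm_of_nonneg hr0] at this
  rw [show heineAt q p = _ from funext (heineAt_eq q p)]
  exact hd.differentiableAt (Metric.isOpen_ball.mem_nhds (mem_ball_zero_iff.2 hr))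

theorem powerSeries_coeff_unique {f : ℂ → ℂ} {a b : ℕ → ℂ}
    (ha : ∀ᶠ z in nhds (0 : ℂ), HasSum (fun n => z ^ n * a n) (f z))
    (hb : ∀ᶠ z in nhds (0 : ℂ), HasSum (fun n => z ^ n * b n) (f z)) : a = b := by
  have key : ∀ a : ℕ → ℂ, (∀ᶠ z in nhds (0 : ℂ), HasSum (fun n => z ^ n * a n) (f z)) →
      HasFPowerSeriesAt f (FormalMultilinearSeries.ofScalars ℂ a) 0 := by
    intro a ha
    rw [hasFPowerSeriesAt_iff]
    simpa [FormalMultilinearSeries.coeff_ofScalars] using ha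
  have h := (key a ha).eq_formalMultilinearSeries (key b hb)
  ext n
  have := congrArg (fun p => FormalMultilinearSeries.coeff p n) h
  simpa [FormalMultilinearSeries.coeff_ofScalars] using this

theorem hasSum_integral_geometric {ν : Measure ℝ} [IsProbabilityMeasure ν]
    (hν : ∀ᵐ t ∂ν, t ∈ Set.Icc (0 : ℝ) 1) {w : ℂ} (hw : ‖w‖ < 1) :
    HasSum (fun n => w ^ n * ((∫ t : ℝ, t ^ n ∂ν : ℝ) : ℂ)) (∫ t : ℝ, 1 / (1 - (t : ℂ) * w) ∂ν) := by
  have hle : ∀ n : ℕ, ∀ᵐ t : ℝ ∂ν, ‖((t : ℂ) * w) ^ n‖ ≤ ‖w‖ ^ n := by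
    intro n
    filter_upwards [hν] with t ht
    rw [norm_pow, norm_mul, Complex.norm_real, Real.norm_of_nonneg ht.1]
    exact pow_le_pow_left₀ (by positivity [ht.1]) (mul_le_of_le_one_left (norm_nonneg w) ht.2) n
  have hint : ∀ n : ℕ, Integrable (fun t : ℝ => ((t : ℂ) * w) ^ n) ν := fun n =>
    integrable_of_continuousOn_Icc hν (by fun_prop)
  have h := hasSum_integral_of_summable_integral_norm hint
    ((summable_geometric_of_lt_one (norm_nonneg w) hw).of_nonneg_of_le
      (fun n => integral_nonneg fun t => norm_nonneg _) fun n => by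
        have := integral_mono_ae (hint n).norm (integrable_const (‖w‖ ^ n)) (hle n)
        simpa using this)
  have e₁ : (fun n => w ^ n * ((∫ t : ℝ, t ^ n ∂ν : ℝ) : ℂ)) =
      fun n => ∫ t : ℝ, ((t : ℂ) * w) ^ n ∂ν := by
    ext n
    simp only [mul_pow]
    rw [integral_mul_const, mul_comm, ← integral_complex_ofReal]
    simp
  have e₂ : ∫ t : ℝ, 1 / (1 - (t : ℂ) * w) ∂ν = ∫ t : ℝ, ∑' n : ℕ, ((t : ℂ) * w) ^ n ∂ν := by
    refine integral_congr_ae ?_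
    filter_upwards [hν] with t ht
    have : ‖(t : ℂ) * w‖ < 1 := by
      rw [norm_mul, Complex.norm_real, Real.norm_of_nonneg ht.1]
      exact (mul_le_of_le_one_left (norm_nonneg w) ht.2).trans_lt hw
    rw [tsum_geometric_of_norm_lt_one this, one_div]
  rw [e₁, e₂]
  exact h

/-- If the transform continues analytically to the unit disk, the measure lives on `[0, q]`. -/
theorem ae_le_of_analytic_continuation {ν : Measure ℝ} [IsProbabilityMeasure ν]
    (hν : ∀ᵐ t ∂ν, t ∈ Set.Icc (0 : ℝ) 1) {q : ℝ} (hq0 : 0 < q) {G : ℂ → ℂ}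
    (hG : DifferentiableOn ℂ G (Metric.ball 0 1))
    (heq : ∀ᶠ z in nhds (0 : ℂ), G z = ∫ t : ℝ, 1 / (1 - (t : ℂ) * (z / q)) ∂ν) :
    ∀ᵐ t ∂ν, t ≤ q := by
  set m : ℕ → ℝ := fun n => ∫ t : ℝ, t ^ n ∂ν with hm
  set a : ℕ → ℂ := fun n => (Nat.factorial n : ℂ)⁻¹ * iteratedDeriv n G 0
  have hTaylor : ∀ z ∈ Metric.ball (0 : ℂ) 1, HasSum (fun n => z ^ n * a n) (G z) := by
    intro z hz
    have := Complex.hasSum_taylorSeries_on_ball hG hz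
    refine this.congr_fun fun n => ?_
    simp only [a, sub_zero, smul_eq_mul]
    ring
  have hmom : ∀ᶠ z in nhds (0 : ℂ), HasSum (fun n => z ^ n * ((m n : ℂ) / q ^ n)) (G z) := by
    filter_upwards [heq, Metric.ball_mem_nhds (0 : ℂ) hq0] with z hz hzq
    rw [hz]
    have := hasSum_integral_geometric hν (w := z / q) (by
      rw [norm_div, Complex.norm_real, Real.norm_of_nonneg hq0.le, div_lt_one hq0]
      simpa using hzq)
    convert this using 2 with n
    rw [div_pow]; ring
  have hcoef := powerSeries_coeff_unique
    (Filter.eventually_of_mem (Metric.ball_mem_nhds (0 : ℂ) one_pos) hTaylor) hmom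
  have hmain : ∀ s : ℝ, q < s → ν (Set.Ici s) = 0 := by
    intro s hs
    have hs0 : 0 < s := hq0.trans hs
    -- With q/s < ρ < 1 the Taylor terms (ρ/q)^n m_n at ρ tend to 0, yet they dominate (ρs/q)^n
    -- ν([s, ∞)) ≥ ν([s, ∞)).
    obtain ⟨ρ, hρ, hρ1⟩ := exists_between ((div_lt_one hs0).2 hs)
    have hρ0 : 0 < ρ := (div_pos hq0 hs0).trans hρ
    have hsum := (hTaylor (ρ : ℂ) (by
      rw [mem_ball_zero_iff, Complex.norm_real, Real.norm_of_nonneg hρ0.le]; exact hρ1)).summable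
    have hlim := hsum.tendsto_atTop_zero.norm
    have hterm : ∀ n, ‖(ρ : ℂ) ^ n * a n‖ = (ρ / q) ^ n * m n := by
      intro n
      have hmn : 0 ≤ m n := integral_nonneg_of_ae (by
        filter_upwards [hν] with t ht
        exact pow_nonneg ht.1 n)
      rw [hcoef]
      rw [norm_mul, norm_div, norm_pow, norm_pow, Complex.norm_real, Complex.norm_real,
        Complex.norm_real, Real.norm_of_nonneg hρ0.le, Real.norm_of_nonneg hq0.le,
        Real.norm_of_nonneg hmn, div_pow]
      ring
    simp only [hterm, norm_zero] at hlim
    have hlow : ∀ n, ν.real (Set.Ici s) ≤ (ρ / q) ^ n * m n := by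
      intro n
      have hint : Integrable (fun t : ℝ => t ^ n) ν :=
        integrable_of_continuousOn_Icc hν (by fun_prop)
      have h1 : s ^ n * ν.real (Set.Ici s) ≤ m n := by
        have h2 : ∫ t in Set.Ici s, s ^ n ∂ν ≤ ∫ t in Set.Ici s, t ^ n ∂ν :=
          setIntegral_mono_on (integrable_const _).integrableOn hint.integrableOn measurableSet_Ici
            fun t ht => pow_le_pow_left₀ hs0.le ht n
        have h3 : ∫ t in Set.Ici s, t ^ n ∂ν ≤ m n :=
          setIntegral_le_integral hint (by
            filter_upwards [hν] with t ht
            exact pow_nonneg ht.1 n)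
        rw [setIntegral_const, smul_eq_mul] at h2
        linarith
      have h4 : 1 ≤ ρ / q * s := by
        rw [div_lt_iff₀ hs0] at hρ
        rw [div_mul_eq_mul_div, le_div_iff₀ hq0, one_mul]
        exact hρ.le
      calc ν.real (Set.Ici s) ≤ (ρ / q * s) ^ n * ν.real (Set.Ici s) :=
            le_mul_of_one_le_left measureReal_nonneg (one_le_pow₀ h4)
        _ = (ρ / q) ^ n * (s ^ n * ν.real (Set.Ici s)) := by rw [mul_pow]; ring
        _ ≤ _ := by gcongr
    have := ge_of_tendsto' hlim hlow
    exact (measureReal_eq_zero_iff).1 (le_antisymm this measureReal_nonneg)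
  have hunion : {t : ℝ | ¬ t ≤ q} = ⋃ n : ℕ, Set.Ici (q + 1 / ((n : ℝ) + 1)) := by
    ext t
    simp only [Set.mem_ofPred_eq, not_le, Set.mem_iUnion, Set.mem_Ici]
    constructor
    · intro h
      obtain ⟨n, hn⟩ := exists_nat_one_div_lt (sub_pos.2 h)
      exact ⟨n, by linarith⟩
    · rintro ⟨n, hn⟩
      have : 0 < 1 / ((n : ℝ) + 1) := by positivity
      linarith
  rw [ae_iff, hunion, measure_iUnion_null_iff]
  intro n
  have : 0 < 1 / ((n : ℝ) + 1) := by positivity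
  exact hmain _ (by linarith)

/-! ### Transfer to Heine's quotient and conclusion. -/

theorem MapsUnivalentlyOntoConvexInImagDirection.congr {f g : ℂ → ℂ} {U : Set ℂ} (hU : IsOpen U)
    (hf : MapsUnivalentlyOntoConvexInImagDirection f U) (h : Set.EqOn f g U) :
    MapsUnivalentlyOntoConvexInImagDirection g U := by
  obtain ⟨h1, h2, h3⟩ := hf
  refine ⟨fun z hz => (h1 z hz).congr ?_, h2.congr h, ?_⟩
  · exact Filter.eventually_of_mem (hU.mem_nhds hz) h
  · rwa [← h.image_eq]

/-- Dilation of a measure carried by `[0, 1]`. -/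
theorem cauchyTransform_map_div (ν : Measure ℝ) (q : ℝ) (z : ℂ) :
    cauchyTransform (ν.map fun t => t / q) z = z * ∫ t : ℝ, 1 / (1 - (t : ℂ) * (z / q)) ∂ν := by
  rw [cauchyTransform, integral_map (by fun_prop)
    (Measurable.aestronglyMeasurable (by fun_prop)), ← integral_const_mul]
  congr 1
  ext t
  push_cast
  rw [mul_one_div, div_mul_eq_mul_div, mul_div_assoc]

theorem stieltjesTransform_eq {q : ℝ} (hq0 : 0 < q) {μ : Set.Icc (0 : ℝ) 1 →o Set.Icc (0 : ℝ) 1}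
    {ν : Measure ℝ} (hμ : stieltjesMeasure μ = ν) (hν : ∀ᵐ t ∂ν, t ∈ Set.Icc (0 : ℝ) 1) :
    stieltjesTransform q μ = cauchyTransform (ν.map fun t => t / q) := by
  ext z
  have hq : (q : ℂ) ≠ 0 := by exact_mod_cast hq0.ne'
  rw [cauchyTransform_map_div, stieltjesTransform, hμ, Measure.restrict_eq_self_of_ae_mem hν,
    ← integral_const_mul]
  congr 1
  ext t
  have : (q : ℂ) - t * z = q * (1 - (t : ℂ) * (z / q)) := by field_simp
  rw [this, mul_div_mul_left _ _ hq, mul_one_div]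

theorem cutPlane_subset_slitDomain {q : ℝ} (hq0 : 0 < q) : cutPlane q ⊆ slitDomain (1 / q) := by
  intro z hz t ht
  have := one_sub_ofReal_mul_ne_zero hq0 hz (t * q)
    ⟨mul_nonneg ht.1 hq0.le, (le_div_iff₀ hq0).1 ht.2⟩
  have hq : (q : ℂ) ≠ 0 := by exact_mod_cast hq0.ne'
  convert this using 2
  push_cast
  field_simp

theorem corollary2p3 (q a b c : ℝ) (hq0 : 0 < q) (hq1 : q < 1)
    (ha : 0 ≤ a) (hb : 0 ≤ b) (hc : 0 ≤ c)
    (hbc0 : 0 ≤ q * (b - c)) (hbc1 : q * (b - c) ≤ 1 - c * q)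
    (hac0 : 0 < a - c) (hac1 : a - c ≤ 1 - c) :
    ∃ μ : Set.Icc (0 : ℝ) 1 →o Set.Icc (0 : ℝ) 1,
      (μ 1 : ℝ) - (μ 0 : ℝ) = 1 ∧
      -- the integral representation of the quotient, on the part of the unit disk off the cut
      (∀ z : ℂ, ‖z‖ < 1 → z ∈ cutPlane q →
        heinePhi a b c q z ≠ 0 ∧
        z * heinePhi a (b * q) (c * q) q z / heinePhi a b c q z = stieltjesTransform q μ z) ∧
      -- the function represented by the integral is analytic in the cut plane
      AnalyticOnNhd ℂ (stieltjesTransform q μ) (cutPlane q) ∧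
      -- its mapping properties on the disk `|z| < q` and on the half-plane `Re z < q`
      MapsUnivalentlyOntoConvexInImagDirection (stieltjesTransform q μ) {z : ℂ | ‖z‖ < q} ∧
      MapsUnivalentlyOntoConvexInImagDirection (stieltjesTransform q μ) {z : ℂ | z.re < q} ∧
      -- the mapping property on the unit disk, whenever the quotient has no poles there
      ((∀ z : ℂ, ‖z‖ < 1 → heinePhi a b c q z ≠ 0) →
        MapsUnivalentlyOntoConvexInImagDirection
          (fun z => z * heinePhi a (b * q) (c * q) q z / heinePhi a b c q z)
          {z : ℂ | ‖z‖ < 1}) := by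
  -- The term cq cancels in `hbc1`, leaving qb ≤ 1, while c < a ≤ 1 gives c < 1.
  have hadm : HeineAdmissible q (a, b, c) :=
    ⟨hc, by simp only; linarith, by simp only; linarith, by simp only; linarith,
      by simp only; nlinarith [nonneg_of_mul_nonneg_right hbc0 hq0], by simp only; linarith⟩
  have hΦ : ∀ z, heinePhi a b c q z = heineAt q (a, b, c) z := fun z => rfl
  have hΨ : ∀ z, heinePhi a (b * q) (c * q) q z = heineAt q (heineShift q (a, b, c)) z := by
    intro z
    rw [← Complex.ofReal_mul, ← Complex.ofReal_mul, heinePhi_symm]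
    rfl
  obtain ⟨ν, hprob, hν, hrep⟩ := hadm.exists_measure hq0 hq1
  obtain ⟨μ, hμ1, hμ0, hμ⟩ := exists_stieltjesMeasure_eq ν hν
  have hprob' : IsProbabilityMeasure (ν.map fun t => t / q) :=
    Measure.isProbabilityMeasure_map (by fun_prop)
  have hmap : ∀ R : ℝ, (∀ᵐ t ∂ν, t ∈ Set.Icc 0 (R * q)) →
      ∀ᵐ t ∂(ν.map fun t => t / q), t ∈ Set.Icc 0 R := by
    intro R hR
    refine (ae_map_iff (p := fun t => t ∈ Set.Icc 0 R) (by fun_prop) measurableSet_Icc).2 ?_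
    filter_upwards [hR] with t ht
    exact ⟨div_nonneg ht.1 hq0.le, (div_le_iff₀ hq0).2 ht.2⟩
  -- Dividing t by q turns qz/(q - tz) into the Cauchy kernel and carries the measure to [0, 1/q],
  -- with half-plane Re z < q.
  have hν' := hmap (1 / q) (by rwa [one_div, inv_mul_cancel₀ hq0.ne'])
  refine ⟨μ, by rw [hμ1, hμ0, sub_zero], ?_⟩
  rw [stieltjesTransform_eq hq0 hμ hν]
  have hquot : ∀ z : ℂ, ‖z‖ < 1 → z ∈ cutPlane q →
      heineAt q (heineShift q (a, b, c)) z / heineAt q (a, b, c) z =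
        ∫ t : ℝ, 1 / (1 - (t : ℂ) * (z / q)) ∂ν := by
    intro z hz hzc
    rw [hrep z hz hzc, mul_div_cancel_left₀ _ (hadm.heineAt_ne_zero hq0 hq1 hz hzc)]
  refine ⟨fun z hz hzc => ⟨hadm.heineAt_ne_zero hq0 hq1 hz hzc, ?_⟩, ?_,
    mapsUnivalently_cauchyTransform_ball hq0 hν', mapsUnivalently_cauchyTransform_halfPlane hq0 hν',
    fun hne => ?_⟩
  · rw [hΦ, hΨ, mul_div_assoc, hquot z hz hzc, cauchyTransform_map_div]
  · exact (analyticOnNhd_cauchyTransform (one_div_pos.2 hq0).le hν').mono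
      (cutPlane_subset_slitDomain hq0)
  have hball : {z : ℂ | ‖z‖ < 1} = Metric.ball 0 1 := by ext z; simp
  have hGd : DifferentiableOn ℂ
      (fun z => heineAt q (heineShift q (a, b, c)) z / heineAt q (a, b, c) z)
      (Metric.ball 0 1) := by
    intro z hz
    rw [mem_ball_zero_iff] at hz
    exact (((hadm.shift hq0 hq1).differentiableAt hq0 hq1 hz).div
      (hadm.differentiableAt hq0 hq1 hz) (hne z hz)).differentiableWithinAt
  have hnear : ∀ᶠ z in nhds (0 : ℂ),
      heineAt q (heineShift q (a, b, c)) z / heineAt q (a, b, c) z =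
        ∫ t : ℝ, 1 / (1 - (t : ℂ) * (z / q)) ∂ν := by
    filter_upwards [Metric.ball_mem_nhds (0 : ℂ) hq0] with z hz
    rw [mem_ball_zero_iff] at hz
    refine hquot z (hz.trans hq1) ?_
    rintro ⟨x, hx, rfl⟩
    rw [Complex.norm_real] at hz
    exact absurd ((le_abs_self x).trans_lt hz) (not_lt.2 hx)
  -- With ν carried by [0, q], the rescaled measure lives on [0, 1] and the disk theorem applies
  -- with radius 1.
  have hle := ae_le_of_analytic_continuation hν hq0 hGd hnear
  have hν1 := hmap (1 / 1) (by
    filter_upwards [hν, hle] with t h1 h2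
    exact ⟨h1.1, by linarith⟩)
  refine (mapsUnivalently_cauchyTransform_ball one_pos hν1).congr
    (hball ▸ Metric.isOpen_ball) ?_
  rw [hball]
  -- The representation is known only off the cut; the identity theorem extends it from a
  -- neighbourhood of 0 across [q, 1).
  refine AnalyticOnNhd.eqOn_of_preconnected_of_eventuallyEq (z₀ := 0)
    (by rw [← hball]; exact (mapsUnivalently_cauchyTransform_ball one_pos hν1).1)
    (DifferentiableOn.analyticOnNhd ?_ Metric.isOpen_ball) (convex_ball _ _).isPreconnected
    (Metric.mem_ball_self one_pos) ?_
  · simp only [hΦ, hΨ, mul_div_assoc]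
    exact differentiableOn_id.mul hGd
  · filter_upwards [hnear] with z hz
    rw [hΦ, hΨ, mul_div_assoc, hz, cauchyTransform_map_div]
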